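/- **Curvature estimates for $(\rho,\gamma)$.** Let $d\ge 1$ and let $\mathcal M(\mathbb R^d)$ be the set of finite nonnegative Borel measures on $\mathbb R^d$ with the weak topology (duality with bounded continuous functions). The Hellinger–Kantorovich distance is $$\mathsf{HK}(\mu_0,\mu_1)^2=\inf\int_0^1\!\!\int_{\mathbb R^d}\big(|V(t,x)|^2+4\,\zeta(t,x)^2\big)\,d\mu_t(x)\,dt ,$$ the infimum being over weakly continuous curves $(\mu_t)_{t\in[0,1]}$ in $\mathcal M(\mathbb R^d)$ from $\mu_0$ to $\mu_1$ and Borel fields $V,\zeta$ with $\partial_t\mu+\operatorname{div}(\mu V)=4\zeta\mu$ in $\mathcal D'((0,1)\times\mathbb R^d)$. Let $(\mu_t)_{t\in[0,1]}$ be a geodesic, i.e. $\mathsf{HK}(\mu_s,\mu_t)=|s-t|\,\mathsf{HK}(\mu_0,\mu_1)$ for all $s,t\in[0,1]$. Put $\mathrm L(z)=\frac12\log(1+\tan^2|z|)$ for $|z|<\pi/2$ and $\mathrm L(z)=+\infty$ otherwise. Let $(\varphi_0,\varphi_1)$ be a tight optimal pair of potentials for $(\mu_0,\mu_1)$, i.e.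 $\varphi_0,\varphi_1:\mathbb R^d\to[-\infty,+\infty]$ are lower, respectively upper, semicontinuous, $\int e^{2\varphi_0}d\mu_0<\infty$, $\int e^{-2\varphi_1}d\mu_1<\infty$, $\varphi_1(x_1)\le \mathrm L(x_1-x_0)+\varphi_0(x_0)$ whenever $|x_0-x_1|<\pi/2$, $$\varphi_0(x_0)=\sup_{|x_1-x_0|<\pi/2}\big(\varphi_1(x_1)-\mathrm L(x_1-x_0)\big),\qquad \varphi_1(x_1)=\inf_{|x_0-x_1|<\pi/2}\big(\varphi_0(x_0)+\mathrm L(x_1-x_0)\big),$$ and, with $\xi_0=\frac12(e^{2\varphi_0}-1)\in[-\frac12,+\infty]$ and $\bar\xi_1=\frac12(1-e^{-2\varphi_1})\in[-\infty,\frac12]$, one has $\frac12\mathsf{HK}(\mu_0,\mu_1)^2=\int\bar\xi_1\,d\mu_1-\int\xi_0\,d\mu_0$. For $t\in(0,1)$ and $\xi:\mathbb R^d\to[-\frac12,+\infty]$ put $$\mathscr P_t\xi(x)=\inf_{y\in\mathbb R^d}\frac1{2t}\Big(1-\frac{\cos^2(\min\{|x-y|,\pi/2\})}{1+2t\xi(y)}\Big)$$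 (the quotient is $0$ where $\xi(y)=+\infty$), and set $\xi_t=\mathscr P_t\xi_0$, $\bar\xi_t=-\mathscr P_{1-t}(-\bar\xi_1)$ and $\Xi_t=\{x:\xi_t(x)=\bar\xi_t(x)\}$. For $s\in(0,1)$ let $\mathfrak D_s$ be the set of those $x\in\Xi_s$ that are Lebesgue density points of $\Xi_s$ and at which $\nabla\xi_s$ is differentiable along $\Xi_s$, i.e. $\nabla\xi_s(y)=\nabla\xi_s(x)+A(y-x)+o(|y-x|)$ as $y\to x$, $y\in\Xi_s$, for some matrix $A$. For $s,t\in(0,1)$ set, with $\boldsymbol{\arctan}(w)=\arctan(|w|)\frac{w}{|w|}$ and $\boldsymbol{\arctan}(0)=0$, $$T_{s\to t}(x)=x+\boldsymbol{\arctan}\Big(\frac{(t-s)\nabla\xi_s(x)}{1+2(t-s)\xi_s(x)}\Big),\qquad q_{s\to t}(x)=\Big(\big(1+2(t-s)\xi_s(x)\big)^2+(t-s)^2|\nabla\xi_s(x)|^2\Big)^{1/2},$$ and, for $x\in\mathfrak D_s$, $$\gamma_s(t,x)=q_{s\to t}(x),\qquad \rho_s(t,x)=q_{s\to t}(x)\,\big(\det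 \mathrm D T_{s\to t}(x)\big)^{1/d},$$ where $\mathrm D T_{s\to t}(x)$ is the differential of $T_{s\to t}$ along $\Xi_s$. Then for every $s\in(0,1)$ and $x\in\mathfrak D_s$: for all $t\in(0,1)$ the map $T_{s\to t}$ is differentiable along $\Xi_s$ at $x$ with $\det\mathrm D T_{s\to t}(x)>0$, so $\gamma_s(t,x)>0$ and $\rho_s(t,x)>0$; the functions $\gamma_s(\cdot,x)$ and $\rho_s(\cdot,x)$ are of class $C^2$ on $(0,1)$; and for all $t\in(0,1)$, with dots denoting derivatives in $t$, $$\frac{\ddot\gamma_s(t,x)}{\gamma_s(t,x)}\ge 0\qquad\text{and}\qquad \frac{\ddot\rho_s(t,x)}{\rho_s(t,x)}\le\Big(1-\frac4d\Big)\frac{\ddot\gamma_s(t,x)}{\gamma_s(t,x)}\quad\text{if } d\ge2,$$ with equality in the last relation if $d=1$. -/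

import Mathlib

open MeasureTheory Set Filter Topology
open scoped ENNReal ContDiff

noncomputable section

namespace HellKant

/-- Euclidean space of dimension `d`. -/
abbrev Eu (d : ℕ) : Type := EuclideanSpace ℝ (Fin d)

variable {d : ℕ}

/-! ### The Hellinger--Kantorovich distance and its geodesics -/

/-- Distributional form, on `(0,1) × ℝᵈ`, of the generalized continuity equation
`∂ₜ μ + div (μ V) = 4 ξ μ`.  The value `fderiv ℝ η (t, x) (1, V)` is `∂ₜ η + ⟨∇η, V⟩`. -/
def SolvesGCE (μ : ℝ → FiniteMeasure (Eu d)) (V : ℝ × Eu d → Eu d) (ξ : ℝ × Eu d → ℝ) : Prop :=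
  ∀ η : ℝ × Eu d → ℝ, ContDiff ℝ ∞ η → HasCompactSupport η →
    tsupport η ⊆ Ioo (0 : ℝ) 1 ×ˢ (univ : Set (Eu d)) →
    ∫ t in Ioo (0 : ℝ) 1, ∫ x, (fderiv ℝ η (t, x) (1, V (t, x)) + 4 * ξ (t, x) * η (t, x))
      ∂(μ t : Measure (Eu d)) = 0

/-- Competitors of the dynamic formulation: weakly continuous curves of finite measures from
`μ₀` to `μ₁` with Borel fields solving the generalized continuity equation. -/
structure IsCompetitor (μ₀ μ₁ : FiniteMeasure (Eu d)) (μ : ℝ → FiniteMeasure (Eu d))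
    (V : ℝ × Eu d → Eu d) (ξ : ℝ × Eu d → ℝ) : Prop where
  continuousOn : ContinuousOn μ (Icc 0 1)
  measurable_V : Measurable V
  measurable_ξ : Measurable ξ
  left : μ 0 = μ₀
  right : μ 1 = μ₁
  gce : SolvesGCE μ V ξ

/-- The action `∫₀¹ ∫ |V|² + 4 ξ² dμₜ dt`. -/
def action (μ : ℝ → FiniteMeasure (Eu d)) (V : ℝ × Eu d → Eu d) (ξ : ℝ × Eu d → ℝ) : ℝ≥0∞ :=
  ∫⁻ t in Ioo (0 : ℝ) 1, ∫⁻ x, ENNReal.ofReal (‖V (t, x)‖ ^ 2 + 4 * ξ (t, x) ^ 2)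
    ∂(μ t : Measure (Eu d))

/-- The squared Hellinger--Kantorovich distance (dynamic formulation, parameters `1` and `4`). -/
def hkSq (μ₀ μ₁ : FiniteMeasure (Eu d)) : ℝ≥0∞ :=
  ⨅ (μ : ℝ → FiniteMeasure (Eu d)) (V : ℝ × Eu d → Eu d) (ξ : ℝ × Eu d → ℝ)
    (_ : IsCompetitor μ₀ μ₁ μ V ξ), action μ V ξ

/-- The Hellinger--Kantorovich distance. -/
def hk (μ₀ μ₁ : FiniteMeasure (Eu d)) : ℝ := Real.sqrt (hkSq μ₀ μ₁).toReal

/-- Constant-speed geodesics `(μₜ)`, `t ∈ [0,1]`. -/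
def IsGeodesic (μ : ℝ → FiniteMeasure (Eu d)) : Prop :=
  ∀ s ∈ Icc (0 : ℝ) 1, ∀ t ∈ Icc (0 : ℝ) 1, hk (μ s) (μ t) = |s - t| * hk (μ 0) (μ 1)

/-! ### Optimal potentials -/

/-- The cost `z ↦ ½ log (1 + tan² |z|)`, equal to `+∞` for `|z| ≥ π/2`. -/
def cost (z : Eu d) : EReal :=
  if ‖z‖ < Real.pi / 2 then ((Real.log (1 + Real.tan ‖z‖ ^ 2) / 2 : ℝ) : EReal) else ⊤

/-- The forward transform of a potential for the cost `cost`. -/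
def forwardTransform (φ₀ : Eu d → EReal) (x₁ : Eu d) : EReal :=
  ⨅ x₀ ∈ Metric.ball x₁ (Real.pi / 2), (φ₀ x₀ + cost (x₁ - x₀))

/-- The backward transform of a potential for the cost `cost`. -/
def backwardTransform (φ₁ : Eu d → EReal) (x₀ : Eu d) : EReal :=
  ⨆ x₁ ∈ Metric.ball x₀ (Real.pi / 2), (φ₁ x₁ - cost (x₁ - x₀))

/-- `φ ↦ (e^{2φ} - 1) / 2`, with the values `-1/2` at `-∞` and `+∞` at `+∞`. -/
def gCheck (φ : EReal) : EReal := ((EReal.exp (2 * φ) : EReal) - 1) / 2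

/-- `φ ↦ (1 - e^{-2φ}) / 2`, with the values `-∞` at `-∞` and `1/2` at `+∞`. -/
def gHat (φ : EReal) : EReal := -gCheck (-φ)

/-- Optimal pairs of potentials `φ₀, φ₁ : ℝᵈ → [-∞,+∞]` for the dual formulation of
`½ HK²(μ₀, μ₁)` which are tight, i.e. each one is the transform of the other one. -/
structure IsTightOptimalPair (μ₀ μ₁ : FiniteMeasure (Eu d)) (φ₀ φ₁ : Eu d → EReal) : Prop where
  lsc : LowerSemicontinuous φ₀
  usc : UpperSemicontinuous φ₁
  lintegral_left : ∫⁻ x, EReal.exp (2 * φ₀ x) ∂(μ₀ : Measure (Eu d)) < ⊤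
  lintegral_right : ∫⁻ x, EReal.exp (-(2 * φ₁ x)) ∂(μ₁ : Measure (Eu d)) < ⊤
  le_cost : ∀ x₀ x₁ : Eu d, ‖x₀ - x₁‖ < Real.pi / 2 → φ₁ x₁ ≤ cost (x₁ - x₀) + φ₀ x₀
  optimal : hk μ₀ μ₁ ^ 2 / 2 =
    ∫ x, (gHat (φ₁ x)).toReal ∂(μ₁ : Measure (Eu d)) -
      ∫ x, (gCheck (φ₀ x)).toReal ∂(μ₀ : Measure (Eu d))
  tight_left : φ₀ = backwardTransform φ₁
  tight_right : φ₁ = forwardTransform φ₀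

/-! ### The Hopf--Lax flows and the contact sets -/

/-- The truncated cosine `cos (min r (π/2))`. -/
def cosTrunc (r : ℝ) : ℝ := Real.cos (min r (Real.pi / 2))

/-- The generalized Hopf--Lax operator
`(P_t ξ)(x) = inf_y (1/(2t)) (1 - cos²(min |x-y| (π/2)) / (1 + 2 t ξ(y)))`, for functions `ξ ≥ -1/2`
with values in `[-1/2,+∞]` and for `0 < t < 1`; the quotient is `0` where `ξ(y) = +∞`. -/
def hopfLax (t : ℝ) (ξ : Eu d → EReal) (x : Eu d) : EReal :=
  ⨅ y : Eu d, ((1 / (2 * t) : ℝ) : EReal) *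
    (1 - ((cosTrunc ‖x - y‖ ^ 2 : ℝ) : EReal) / (1 + ((2 * t : ℝ) : EReal) * ξ y))

/-- The backward Hopf--Lax operator. -/
def hopfLaxBack (t : ℝ) (ξ : Eu d → EReal) (x : Eu d) : EReal :=
  -hopfLax t (fun y => -ξ y) x

/-- The forward solution `ξ_t = P_t ξ₀`, with `ξ₀ = (e^{2φ₀} - 1) / 2`, for `0 < t < 1`. -/
def forwardSol (φ₀ : Eu d → EReal) (t : ℝ) : Eu d → EReal :=
  hopfLax t fun y => gCheck (φ₀ y)

/-- The backward solution `R_{1-t} ξ₁`, with `ξ₁ = (1 - e^{-2φ₁}) / 2`, for `0 < t < 1`. -/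
def backwardSol (φ₁ : Eu d → EReal) (t : ℝ) : Eu d → EReal :=
  hopfLaxBack (1 - t) fun y => gHat (φ₁ y)

/-- The contact set `Ξ_t` of the forward and the backward solution. -/
def contactSet (φ₀ φ₁ : Eu d → EReal) (t : ℝ) : Set (Eu d) :=
  {x | backwardSol φ₁ t x = forwardSol φ₀ t x}

/-- The forward solution as a real function (it is finite for `0 < t < 1`). -/
def pot (φ₀ : Eu d → EReal) (t : ℝ) (x : Eu d) : ℝ := (forwardSol φ₀ t x).toReal

/-- The gradient `∇ξ_t`. -/
def gradPot (φ₀ : Eu d → EReal) (t : ℝ) (x : Eu d) : Eu d := gradient (pot φ₀ t) x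

/-- Lebesgue density points of a set. -/
def IsDensityPoint (S : Set (Eu d)) (x : Eu d) : Prop :=
  Tendsto (fun r : ℝ => volume (S ∩ Metric.ball x r) / volume (Metric.ball x r))
    (𝓝[>] 0) (𝓝 1)

/-- The set `𝔇_s` of the density points of the contact set `Ξ_s`, belonging to it, at which `∇ξ_s`
is differentiable along `Ξ_s`. -/
def domHess (φ₀ φ₁ : Eu d → EReal) (s : ℝ) : Set (Eu d) :=
  {x | x ∈ contactSet φ₀ φ₁ s ∧ IsDensityPoint (contactSet φ₀ φ₁ s) x ∧
    DifferentiableWithinAt ℝ (gradPot φ₀ s) (contactSet φ₀ φ₁ s) x}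

/-! ### The transport-dilation maps -/

/-- The vector-valued arctangent `w ↦ arctan(|w|) w / |w|`, equal to `0` at `0`. -/
def vecArctan (w : Eu d) : Eu d := (Real.arctan ‖w‖ / ‖w‖) • w

/-- The transport map `T_{s→t}(x) = x + arctan ((t-s) ∇ξ_s(x) / (1 + 2 (t-s) ξ_s(x)))`. -/
def transport (φ₀ : Eu d → EReal) (s t : ℝ) (x : Eu d) : Eu d :=
  x + vecArctan (((t - s) / (1 + 2 * (t - s) * pot φ₀ s x)) • gradPot φ₀ s x)

/-- The dilation factor `q_{s→t}(x) = ((1 + 2 (t-s) ξ_s(x))² + (t-s)² |∇ξ_s(x)|²)^{1/2}`. -/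
def dilation (φ₀ : Eu d → EReal) (s t : ℝ) (x : Eu d) : ℝ :=
  Real.sqrt ((1 + 2 * (t - s) * pot φ₀ s x) ^ 2 + (t - s) ^ 2 * ‖gradPot φ₀ s x‖ ^ 2)

/-- The determinant of the differential of `T_{s→t}` along the contact set `Ξ_s`. -/
def detTransport (φ₀ φ₁ : Eu d → EReal) (s t : ℝ) (x : Eu d) : ℝ :=
  (fderivWithin ℝ (transport φ₀ s t) (contactSet φ₀ φ₁ s) x).det

/-- `γ_s(t,x) = q_{s→t}(x)`. -/
def gammaFun (φ₀ : Eu d → EReal) (s t : ℝ) (x : Eu d) : ℝ := dilation φ₀ s t x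

/-- `ρ_s(t,x) = q_{s→t}(x) (det D T_{s→t}(x))^{1/d}`. -/
def rhoFun (φ₀ φ₁ : Eu d → EReal) (s t : ℝ) (x : Eu d) : ℝ :=
  dilation φ₀ s t x * detTransport φ₀ φ₁ s t x ^ (1 / (d : ℝ))

end HellKant

end

namespace HellKant

variable {d : ℕ}

/-! ### The truncated squared cosine -/

/-! Fix `s` and `x` in `domHess`, and let `f`, `p`, `H` be the value of ξ_s at x, its gradient, and
the differential of the gradient along the contact set. Everything reduces to an ordinary
differential inequality for a matrix Jacobi field in one angular variable.

Geometry at a contact point. Both Hopf–Lax infima are attained, and the admissibility of the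
potentials orders the backward below the forward solution (`weight_duality`). At a contact point ξ_s
is therefore squeezed between two profiles of the form const + const · cos²|z - y|. This gives
differentiability with a uniform quadratic remainder (`contactSet_quadratic_bound`). Blowing up at a
density point shows that H is symmetric (`second_order_expansion`) and that the Hessians of the two
profiles bound H from below and from above.

Time change. With τ = t - s, set β = arctan(τ|p| / (1 + 2τf)), or β = τ / (1 + 2τf) if p = 0. Then
dβ/dτ = c/q², where c = `speed p`. If P projects onto the direction of p and K = H/c, the
differential of the transport is B(β) = diag(cos 2β, 1) + diag(sin 2β / 2, β) K, in blocks along P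
and 1 - P (`hasFDerivWithinAt_transport`). Thus B'' = -4PB, with B(0) = 1 and B'(0) = K. The profile
touching ξ_s from below bounds K below by -diag(2 cot 2r, 1/r), where r is the angle reached at the
touching time; since cot and 1/β decrease, det B stays positive before that time
(`TouchedBelow.quadForm_pos`). Time reversal, with ξ_s replaced by -ξ_s, covers t < s.

Concavity. Restarting the Jacobi field at β gives B(β + ε) = J(ε) B(β), with J generated by the
symmetric matrix U = B'B⁻¹. The arithmetic–geometric mean inequality bounds (det J)^{1/d} by an
explicit function with second derivative -4k/d at 0, where k = |`dir p`|² is 1 or 0. Hence g = (det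
B)^{1/d} satisfies g'' ≤ -(4k/d) g, with equality when d = 1 (`exists_hasSecondDerivAt_det_rpow`).

Conclusion. γ = q satisfies q'' = |p|²/q³. In ρ = q · g(β) the first-order cross terms cancel
because β' = c/q², so ρ'' = q''g + c²g''/q³. Since kc² = |p|², dividing by ρ gives ρ''/ρ ≤ (1 -
4/d)|p|²/q⁴ = (1 - 4/d) γ''/γ. -/

lemma cos_add_ge (A B : ℝ) : Real.cos A - B * Real.sin A - B ^ 2 / 2 ≤ Real.cos (A + B) := by
  have hd : ∀ t, HasDerivAt (fun t : ℝ => Real.cos t + t ^ 2 / 2) (-Real.sin t + t) t := by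
    intro t
    exact ((Real.hasDerivAt_cos t).fun_add ((hasDerivAt_pow 2 t).div_const 2)).congr_deriv
      (by norm_num)
  have hderiv : deriv (fun t : ℝ => Real.cos t + t ^ 2 / 2) = fun t => -Real.sin t + t :=
    funext fun t => (hd t).deriv
  -- The derivative t - sin t is monotone, so this function is convex and lies above its tangent at
  -- A; that is the claim.
  have hconv : ConvexOn ℝ univ (fun t : ℝ => Real.cos t + t ^ 2 / 2) := by
    refine Monotone.convexOn_univ_of_deriv (fun t => (hd t).differentiableAt) ?_
    rw [hderiv]
    intro u v huv
    have h1 := Real.abs_sin_sub_sin_le v u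
    rw [abs_of_nonneg (sub_nonneg.2 huv)] at h1
    have := (abs_le.1 h1).2
    simp only
    linarith
  rcases lt_trichotomy B 0 with hB | hB | hB
  · have h := hconv.slope_le_deriv (mem_univ (A + B)) (mem_univ A) (by linarith)
      (hd A).differentiableAt
    rw [(hd A).deriv, slope_def_field, div_le_iff₀ (by linarith)] at h
    nlinarith
  · simp [hB]
  · have h := hconv.deriv_le_slope (mem_univ A) (mem_univ (A + B)) (by linarith)
      (hd A).differentiableAt
    rw [(hd A).deriv, slope_def_field, le_div_iff₀ (by linarith)] at h
    nlinarith

lemma cos_sq_add_ge (A B : ℝ) :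
    Real.cos A ^ 2 - B * Real.sin (2 * A) - B ^ 2 ≤ Real.cos (A + B) ^ 2 := by
  have h := cos_add_ge (2 * A) (2 * B)
  rw [show 2 * A + 2 * B = 2 * (A + B) by ring, Real.cos_two_mul, Real.cos_two_mul] at h
  nlinarith

lemma cosTrunc_of_le {r : ℝ} (h : r ≤ Real.pi / 2) : cosTrunc r = Real.cos r := by
  rw [cosTrunc, min_eq_left h]

lemma cosTrunc_of_ge {r : ℝ} (h : Real.pi / 2 ≤ r) : cosTrunc r = 0 := by
  rw [cosTrunc, min_eq_right h, Real.cos_pi_div_two]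

lemma cosTrunc_sq_le_one (r : ℝ) : cosTrunc r ^ 2 ≤ 1 := Real.cos_sq_le_one _

lemma cosTrunc_sq_ge {r r' : ℝ} (hr : 0 ≤ r) :
    cosTrunc r ^ 2 - Real.sin (2 * min r (Real.pi / 2)) * (r' - r) - (r' - r) ^ 2
      ≤ cosTrunc r' ^ 2 := by
  rcases le_total r (Real.pi / 2) with h | h
  · rw [min_eq_left h, cosTrunc_of_le h]
    rcases le_total r' (Real.pi / 2) with h' | h'
    · rw [cosTrunc_of_le h']
      have := cos_sq_add_ge r (r' - r)
      rw [add_sub_cancel] at this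
      linarith
    · rw [cosTrunc_of_ge h']
      -- Beyond π/2 the right side stays 0 while the left side decreases in r', because sin(2r) ≥ 0;
      -- the bound at r' = π/2 suffices.
      have h1 := cos_sq_add_ge r (Real.pi / 2 - r)
      rw [add_sub_cancel, Real.cos_pi_div_two] at h1
      have hs : 0 ≤ Real.sin (2 * r) :=
        Real.sin_nonneg_of_nonneg_of_le_pi (by linarith) (by linarith)
      nlinarith
  · rw [min_eq_right h, cosTrunc_of_ge h, show 2 * (Real.pi / 2) = Real.pi by ring, Real.sin_pi]
    nlinarith [sq_nonneg (cosTrunc r'), sq_nonneg (r' - r)]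

/-- The squared truncated cosine of the norm. -/
noncomputable def cosSq (v : Eu d) : ℝ := cosTrunc ‖v‖ ^ 2

/-- The gradient of `cosSq`. -/
noncomputable def cosSqGrad (v : Eu d) : Eu d :=
  -(Real.sin (2 * min ‖v‖ (Real.pi / 2)) / ‖v‖) • v

lemma cosSq_nonneg (v : Eu d) : 0 ≤ cosSq v := sq_nonneg _

lemma cosSq_le_one (v : Eu d) : cosSq v ≤ 1 := cosTrunc_sq_le_one _

lemma continuous_cosSq : Continuous (cosSq : Eu d → ℝ) := by
  unfold cosSq cosTrunc
  fun_prop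

/-- Put u = |v+h| - |v|, so that u² + 2|v|u = 2⟨v,h⟩ + |h|². This trades the radial remainder u² for
|h|² and leaves the term (2|v| - sin)u. Its coefficient is nonnegative, and convexity of the norm
gives u ≥ ⟨v,h⟩/|v|. -/
lemma cosSq_add_ge (v h : Eu d) :
    cosSq v + inner ℝ (cosSqGrad v) h - ‖h‖ ^ 2 ≤ cosSq (v + h) := by
  have h1 := cosTrunc_sq_ge (r := ‖v‖) (r' := ‖v + h‖) (norm_nonneg v)
  have h2 : ‖v + h‖ ^ 2 = ‖v‖ ^ 2 + 2 * inner ℝ v h + ‖h‖ ^ 2 := norm_add_sq_real v h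
  rw [cosSqGrad, inner_smul_left]
  simp only [cosSq, conj_trivial]
  set m := min ‖v‖ (Real.pi / 2)
  rcases eq_or_ne v 0 with rfl | hv
  · have hm : m = 0 := by
      rw [show m = min ‖(0 : Eu d)‖ (Real.pi / 2) from rfl, norm_zero,
        min_eq_left (by positivity)]
    rw [hm] at h1
    simp at h1 ⊢
    linarith
  have hr : 0 < ‖v‖ := norm_pos_iff.2 hv
  have hm : 0 ≤ m := le_min hr.le (by positivity)
  have hs : Real.sin (2 * m) ≤ 2 * ‖v‖ :=
    (Real.sin_le (by linarith)).trans (by linarith [min_le_left ‖v‖ (Real.pi / 2)])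
  have h3 : inner ℝ v (v + h) ≤ ‖v‖ * ‖v + h‖ := real_inner_le_norm _ _
  rw [inner_add_right, real_inner_self_eq_norm_sq] at h3
  have h4 : inner ℝ v h / ‖v‖ ≤ ‖v + h‖ - ‖v‖ := by
    rw [div_le_iff₀ hr]; nlinarith
  have h5 := mul_le_mul_of_nonneg_left h4 (sub_nonneg.2 hs)
  have h6 : (2 * ‖v‖ - Real.sin (2 * m)) * (inner ℝ v h / ‖v‖)
      = 2 * inner ℝ v h - Real.sin (2 * m) / ‖v‖ * inner ℝ v h := by
    field_simp
  rw [h6] at h5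
  nlinarith

/-! ### Second-order lower expansion of the squared cosine -/

lemma cos_add_ge_cubic {A B : ℝ} (hB : |B| ≤ 1) :
    Real.cos A - B * Real.sin A - B ^ 2 / 2 * Real.cos A - |B| ^ 3 ≤ Real.cos (A + B) := by
  have hc := Real.cos_bound hB
  have hs := Real.sin_bound hB
  have e1 : |(Real.cos B - (1 - B ^ 2 / 2)) * Real.cos A| ≤ |B| ^ 4 * (5 / 96) := by
    rw [abs_mul]
    exact (mul_le_of_le_one_right (abs_nonneg _) (Real.abs_cos_le_one A)).trans hc
  have e2 : |(Real.sin B - (B - B ^ 3 / 6)) * Real.sin A| ≤ |B| ^ 5 / 100 := by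
    rw [abs_mul]
    exact (mul_le_of_le_one_right (abs_nonneg _) (Real.abs_sin_le_one A)).trans hs
  have e3 : |B ^ 3 / 6 * Real.sin A| ≤ |B| ^ 3 / 6 := by
    rw [abs_mul, abs_div, abs_pow, abs_of_pos (by norm_num : (0 : ℝ) < 6)]
    exact mul_le_of_le_one_right (by positivity) (Real.abs_sin_le_one A)
  have h4 : |B| ^ 4 ≤ |B| ^ 3 := pow_le_pow_of_le_one (abs_nonneg _) hB (by norm_num)
  have h5 : |B| ^ 5 ≤ |B| ^ 3 := pow_le_pow_of_le_one (abs_nonneg _) hB (by norm_num)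
  have := (abs_le.1 e1).1
  have := (abs_le.1 e2).2
  have := (abs_le.1 e3).1
  have h3 : 0 ≤ |B| ^ 3 := by positivity
  rw [Real.cos_add]
  nlinarith

lemma cos_sq_add_ge_cubic {A B : ℝ} (hB : |B| ≤ 1 / 2) :
    Real.cos A ^ 2 - B * Real.sin (2 * A) - B ^ 2 * Real.cos (2 * A) - 4 * |B| ^ 3
      ≤ Real.cos (A + B) ^ 2 := by
  have h := cos_add_ge_cubic (A := 2 * A) (B := 2 * B)
    (by rw [abs_mul, abs_of_pos (by norm_num : (0 : ℝ) < 2)]; linarith)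
  rw [show 2 * A + 2 * B = 2 * (A + B) by ring, Real.cos_two_mul (A + B), abs_mul,
    abs_of_pos (by norm_num : (0 : ℝ) < 2)] at h
  have h2 := Real.cos_two_mul A
  nlinarith

/-- The Hessian of `cosSq` at `v`, as a quadratic form. -/
noncomputable def cosSqHess (v h : Eu d) : ℝ :=
  -(Real.sin (2 * ‖v‖) / ‖v‖) * ‖h‖ ^ 2 +
    (Real.sin (2 * ‖v‖) / ‖v‖ - 2 * Real.cos (2 * ‖v‖)) * (inner ℝ v h / ‖v‖) ^ 2

lemma cosSq_add_ge_cubic {v : Eu d} (hv : v ≠ 0) (hv' : ‖v‖ < Real.pi / 2) :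
    ∃ C, ∀ᶠ h in 𝓝 (0 : Eu d),
      cosSq v + inner ℝ (cosSqGrad v) h + cosSqHess v h / 2 - C * ‖h‖ ^ 3 ≤ cosSq (v + h) := by
  have hr : 0 < ‖v‖ := norm_pos_iff.2 hv
  set r := ‖v‖ with hr_def
  set D := |Real.sin (2 * r) / (2 * r) - Real.cos (2 * r)|
  -- The 4 is the cubic error of the radial expansion; D/r is the cost of replacing the squared
  -- radial increment u² by (⟨v,h⟩/r)², from which it differs by at most |h|³/r.
  refine ⟨D / r + 4, ?_⟩
  have hc1 : ∀ᶠ h in 𝓝 (0 : Eu d), ‖v + h‖ < Real.pi / 2 := by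
    have : Tendsto (fun h : Eu d => ‖v + h‖) (𝓝 0) (𝓝 ‖v + 0‖) :=
      (continuous_const.add continuous_id).norm.tendsto 0
    rw [add_zero] at this
    exact this.eventually (gt_mem_nhds hv')
  have hc2 : ∀ᶠ h in 𝓝 (0 : Eu d), ‖h‖ < 1 / 2 := by
    have : Tendsto (fun h : Eu d => ‖h‖) (𝓝 0) (𝓝 ‖(0 : Eu d)‖) := continuous_norm.tendsto 0
    rw [norm_zero] at this
    exact this.eventually (gt_mem_nhds (by norm_num))
  filter_upwards [hc1, hc2] with h h1 h2
  rw [cosSqGrad, inner_smul_left, cosSqHess]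
  simp only [conj_trivial, cosSq]
  rw [← hr_def, min_eq_left hv'.le, cosTrunc_of_le hv'.le, cosTrunc_of_le h1.le]
  set u := ‖v + h‖ - r with hu
  have huh : |u| ≤ ‖h‖ := by
    have := abs_norm_sub_norm_le (v + h) v
    rwa [add_sub_cancel_left] at this
  set i := inner ℝ v h with hi
  have hq : u ^ 2 + 2 * r * u = 2 * i + ‖h‖ ^ 2 := by
    have := norm_add_sq_real v h
    rw [hu]; nlinarith
  have hmain := cos_sq_add_ge_cubic (A := r) (B := u) (huh.trans h2.le)
  rw [show r + u = ‖v + h‖ by rw [hu]; ring] at hmain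
  have hi2 : |i / r| ≤ ‖h‖ := by
    rw [abs_div, abs_of_pos hr, div_le_iff₀ hr, mul_comm]
    exact abs_real_inner_le_norm v h
  have hu2 : u ^ 2 ≤ ‖h‖ ^ 2 := by rw [← sq_abs u]; gcongr
  have hdiff : |u ^ 2 - (i / r) ^ 2| ≤ ‖h‖ ^ 3 / r := by
    have e : u - i / r = (‖h‖ ^ 2 - u ^ 2) / (2 * r) := by
      field_simp; linarith
    have e1 : |u - i / r| ≤ ‖h‖ ^ 2 / (2 * r) := by
      rw [e, abs_of_nonneg (div_nonneg (by linarith) (by positivity))]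
      gcongr; nlinarith [sq_nonneg u]
    have e2 : |u + i / r| ≤ 2 * ‖h‖ := (abs_add_le _ _).trans (by linarith)
    rw [show u ^ 2 - (i / r) ^ 2 = (u - i / r) * (u + i / r) by ring, abs_mul]
    calc _ ≤ ‖h‖ ^ 2 / (2 * r) * (2 * ‖h‖) := by gcongr
      _ = _ := by field_simp
  have hD : -(D * (‖h‖ ^ 3 / r)) ≤
      (Real.sin (2 * r) / (2 * r) - Real.cos (2 * r)) * (u ^ 2 - (i / r) ^ 2) := by
    refine (neg_le_neg ?_).trans (neg_abs_le _)
    rw [abs_mul]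
    exact mul_le_mul_of_nonneg_left hdiff (abs_nonneg _)
  have hu3 : |u| ^ 3 ≤ ‖h‖ ^ 3 := by gcongr
  have eu : u = (2 * i + ‖h‖ ^ 2 - u ^ 2) / (2 * r) := by field_simp; linarith
  have es : u * Real.sin (2 * r) = Real.sin (2 * r) / (2 * r) * (2 * i + ‖h‖ ^ 2 - u ^ 2) := by
    rw [div_mul_eq_mul_div, eq_div_iff (by positivity), ← hq]; ring
  rw [es] at hmain
  have e5 : Real.sin (2 * r) / r = 2 * (Real.sin (2 * r) / (2 * r)) := by field_simp
  rw [e5]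
  have e6 : (D / r + 4) * ‖h‖ ^ 3 = D * (‖h‖ ^ 3 / r) + 4 * ‖h‖ ^ 3 := by ring
  rw [e6]
  nlinarith

/-! ### The forward and the backward solutions -/

/-- The weight `1 / (1 + 2 s ξ)` where `ξ = (e^{2φ} - 1) / 2`. -/
noncomputable def weight (s : ℝ) (φ : EReal) : ℝ :=
  ((ENNReal.ofReal (1 - s) + ENNReal.ofReal s * EReal.exp (2 * φ))⁻¹).toReal

lemma weight_bot {s : ℝ} (hs : s < 1) : weight s ⊥ = (1 - s)⁻¹ := by
  have h : (2 : EReal) * ⊥ = ⊥ := EReal.mul_bot_of_pos (by norm_num)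
  rw [weight, h, EReal.exp_bot, mul_zero, add_zero, ENNReal.toReal_inv,
    ENNReal.toReal_ofReal (by linarith)]

lemma weight_top {s : ℝ} (hs : 0 < s) : weight s ⊤ = 0 := by
  have h : (2 : EReal) * ⊤ = ⊤ := EReal.mul_top_of_pos (by norm_num)
  rw [weight, h, EReal.exp_top, ENNReal.mul_top (by simpa using hs), add_top]
  simp

lemma weight_coe {s : ℝ} (hs : s ∈ Ioo (0 : ℝ) 1) (r : ℝ) :
    weight s r = (1 - s + s * Real.exp (2 * r))⁻¹ := by
  have h : (2 : EReal) * (r : EReal) = ((2 * r : ℝ) : EReal) := by push_cast; rfl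
  rw [weight, h, EReal.exp_coe, ← ENNReal.ofReal_mul hs.1.le, ← ENNReal.ofReal_add
    (by linarith [hs.2]) (by have := hs.1; positivity), ENNReal.toReal_inv, ENNReal.toReal_ofReal]
  have := hs.1
  have : 0 ≤ 1 - s := by linarith [hs.2]
  positivity

lemma continuous_weight {s : ℝ} (hs : s ∈ Ioo (0 : ℝ) 1) : Continuous (weight s) := by
  have h2 : Continuous fun φ : EReal => EReal.exp (2 * φ) := by
    have : (fun φ : EReal => EReal.exp (2 * φ)) = fun φ => EReal.exp φ ^ 2 := by
      funext φ
      rw [sq, ← EReal.exp_add]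
      congr 1
      induction φ with
      | bot => exact EReal.mul_bot_of_pos (by norm_num)
      | top => exact EReal.mul_top_of_pos (by norm_num)
      | coe r => exact congrArg ((↑) : ℝ → EReal) (two_mul r)
    rw [this]
    exact (ENNReal.continuous_pow 2).comp ENNReal.continuous_exp
  have h3 : Continuous fun φ : EReal =>
      (ENNReal.ofReal (1 - s) + ENNReal.ofReal s * EReal.exp (2 * φ))⁻¹ :=
    (continuous_const.add ((ENNReal.continuous_const_mul ENNReal.ofReal_ne_top).comp h2)).inv
  refine continuous_iff_continuousAt.2 fun φ => ?_
  refine (ENNReal.continuousAt_toReal ?_).comp h3.continuousAt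
  simp [not_le.2 hs.2]

lemma weight_antitone {s : ℝ} (hs : s ∈ Ioo (0 : ℝ) 1) : Antitone (weight s) := by
  intro φ ψ h
  have hfin : (ENNReal.ofReal (1 - s) + ENNReal.ofReal s * EReal.exp (2 * φ))⁻¹ ≠ ⊤ := by
    simp [not_le.2 hs.2]
  refine ENNReal.toReal_mono hfin (ENNReal.inv_le_inv.2 ?_)
  gcongr

lemma weight_nonneg (s : ℝ) (φ : EReal) : 0 ≤ weight s φ := ENNReal.toReal_nonneg

lemma weight_le {s : ℝ} (hs : s ∈ Ioo (0 : ℝ) 1) (φ : EReal) : weight s φ ≤ (1 - s)⁻¹ := by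
  rw [← weight_bot hs.2]
  exact weight_antitone hs bot_le

/-- Since ξ ≥ -1/2 and s < 1, the denominator is at least 1 - s > 0. Every competitor is thus a real
number, also where the potential is infinite; at +∞ the weight is 0. -/
lemma hopfLax_term {s : ℝ} (hs : s ∈ Ioo (0 : ℝ) 1) (c : ℝ) (φ : EReal) :
    ((1 / (2 * s) : ℝ) : EReal) * (1 - (c : EReal) / (1 + ((2 * s : ℝ) : EReal) * gCheck φ))
      = ((1 / (2 * s) * (1 - c * weight s φ) : ℝ) : EReal) := by
  have hpos : (0 : ℝ) < 2 * s := by linarith [hs.1]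
  have hcoe : ∀ e : ℝ, 0 ≤ e → EReal.exp (2 * φ) = ENNReal.ofReal e →
      weight s φ = (1 - s + s * e)⁻¹ →
      ((1 / (2 * s) : ℝ) : EReal) * (1 - (c : EReal) / (1 + ((2 * s : ℝ) : EReal) * gCheck φ))
        = ((1 / (2 * s) * (1 - c * weight s φ) : ℝ) : EReal) := by
    intro e he h hw
    have hg : gCheck φ = (((e - 1) / 2 : ℝ) : EReal) := by
      rw [gCheck, h, EReal.coe_ennreal_ofReal, max_eq_left he]
      rfl
    have h2 : (c : EReal) / (((1 - s + s * e : ℝ) : EReal)) =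
      ((c / (1 - s + s * e) : ℝ) : EReal) := rfl
    rw [hg, hw, ← EReal.coe_mul, ← EReal.coe_one, ← EReal.coe_add,
      show 1 + 2 * s * ((e - 1) / 2) = 1 - s + s * e by ring, h2, ← EReal.coe_sub,
      ← EReal.coe_mul, div_eq_mul_inv c]
  induction φ with
  | bot =>
    refine hcoe 0 le_rfl ?_ (by rw [weight_bot hs.2, mul_zero, add_zero])
    rw [EReal.mul_bot_of_pos (by norm_num), EReal.exp_bot, ENNReal.ofReal_zero]
  | top =>
    have hg : gCheck ⊤ = ⊤ := by
      rw [gCheck, EReal.mul_top_of_pos (by norm_num), EReal.exp_top, EReal.coe_ennreal_top]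
      exact (congrArg (· / (2 : EReal)) (EReal.top_add_coe (-1))).trans
        (EReal.top_div_of_pos_ne_top (by norm_num) (EReal.coe_ne_top 2))
    have h1 : (1 : EReal) + ⊤ = ⊤ := EReal.coe_add_top 1
    rw [hg, weight_top hs.1, EReal.coe_mul_top_of_pos hpos, h1, EReal.div_top, mul_zero]
    rfl
  | coe r =>
    exact hcoe _ (Real.exp_pos _).le (by rw [← EReal.exp_coe]; rfl) (weight_coe hs r)

lemma forwardSol_eq_iInf {s : ℝ} (hs : s ∈ Ioo (0 : ℝ) 1) (φ : Eu d → EReal) (x : Eu d) :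
    forwardSol φ s x =
      ⨅ y, ((1 / (2 * s) * (1 - cosSq (x - y) * weight s (φ y)) : ℝ) : EReal) := by
  rw [forwardSol, hopfLax]
  exact iInf_congr fun y => hopfLax_term hs _ _

/-- The factor `cosSq` vanishes outside the closed ball of radius π/2, so upper semicontinuity on a
compact set is enough. -/
lemma exists_isMax_cosSq_mul {w : Eu d → ℝ} (hw : UpperSemicontinuous w) (h0 : ∀ y, 0 ≤ w y)
    (x : Eu d) : ∃ y, ∀ z, cosSq (x - z) * w z ≤ cosSq (x - y) * w y := by
  have husc : UpperSemicontinuous fun z => cosSq (x - z) * w z := by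
    intro y m hm
    have hcont : Tendsto (fun κ : ℝ => cosSq (x - y) * κ) (𝓝[>] w y) (𝓝 (cosSq (x - y) * w y)) :=
      ((continuous_const.mul continuous_id).tendsto (w y)).mono_left nhdsWithin_le_nhds
    obtain ⟨κ, hκ, hκ'⟩ := ((hcont.eventually (gt_mem_nhds hm)).and self_mem_nhdsWithin).exists
    have hc : Tendsto (fun z => cosSq (x - z) * κ) (𝓝 y) (𝓝 (cosSq (x - y) * κ)) :=
      ((continuous_cosSq.comp (continuous_const.sub continuous_id)).mul continuous_const).tendsto y
    filter_upwards [hw y κ hκ', hc.eventually (gt_mem_nhds hκ)] with z h1 h2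
    exact (mul_le_mul_of_nonneg_left h1.le (cosSq_nonneg _)).trans_lt h2
  obtain ⟨y, -, hy⟩ := UpperSemicontinuousOn.exists_isMaxOn
    (s := Metric.closedBall x (Real.pi / 2)) ⟨x, Metric.mem_closedBall_self (by positivity)⟩
    (isCompact_closedBall _ _) (husc.upperSemicontinuousOn _)
  refine ⟨y, fun z => ?_⟩
  by_cases hz : z ∈ Metric.closedBall x (Real.pi / 2)
  · exact hy hz
  · have : cosSq (x - z) = 0 := by
      rw [cosSq, cosTrunc_of_ge, zero_pow (by norm_num)]
      rw [Metric.mem_closedBall, dist_comm, dist_eq_norm] at hz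
      linarith
    rw [this, zero_mul]
    exact mul_nonneg (cosSq_nonneg _) (h0 y)

/-- The forward solution is finite and the infimum in its definition is attained. -/
lemma exists_forwardSol_eq {s : ℝ} (hs : s ∈ Ioo (0 : ℝ) 1) {φ : Eu d → EReal}
    (hφ : LowerSemicontinuous φ) (x : Eu d) :
    ∃ y, forwardSol φ s x = ((1 / (2 * s) * (1 - cosSq (x - y) * weight s (φ y)) : ℝ) : EReal) ∧
      ∀ z, cosSq (x - z) * weight s (φ z) ≤ cosSq (x - y) * weight s (φ y) := by
  obtain ⟨y, hy⟩ := exists_isMax_cosSq_mul (w := fun z => weight s (φ z))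
    ((continuous_weight hs).comp_lowerSemicontinuous_antitone hφ (weight_antitone hs))
    (fun z => weight_nonneg _ _) x
  refine ⟨y, ?_, hy⟩
  rw [forwardSol_eq_iInf hs]
  refine le_antisymm (iInf_le _ y) (le_iInf fun z => EReal.coe_le_coe_iff.2 ?_)
  have := hs.1
  have := hy z
  gcongr

lemma backwardSol_eq (φ : Eu d → EReal) (s : ℝ) (x : Eu d) :
    backwardSol φ s x = -forwardSol (fun y => -φ y) (1 - s) x := by
  simp [backwardSol, hopfLaxBack, forwardSol, gHat]

lemma coe_pot {s : ℝ} (hs : s ∈ Ioo (0 : ℝ) 1) {φ : Eu d → EReal}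
    (hφ : LowerSemicontinuous φ) (x : Eu d) : ((pot φ s x : ℝ) : EReal) = forwardSol φ s x := by
  obtain ⟨y, hy, -⟩ := exists_forwardSol_eq hs hφ x
  rw [pot, hy, EReal.toReal_coe]

lemma exists_pot_eq {s : ℝ} (hs : s ∈ Ioo (0 : ℝ) 1) {φ : Eu d → EReal}
    (hφ : LowerSemicontinuous φ) (x : Eu d) :
    ∃ y, pot φ s x = 1 / (2 * s) * (1 - cosSq (x - y) * weight s (φ y)) := by
  obtain ⟨y, hy, -⟩ := exists_forwardSol_eq hs hφ x
  exact ⟨y, by rw [pot, hy, EReal.toReal_coe]⟩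

lemma pot_le {s : ℝ} (hs : s ∈ Ioo (0 : ℝ) 1) {φ : Eu d → EReal}
    (hφ : LowerSemicontinuous φ) (x y : Eu d) :
    pot φ s x ≤ 1 / (2 * s) * (1 - cosSq (x - y) * weight s (φ y)) := by
  rw [← EReal.coe_le_coe_iff, coe_pot hs hφ, forwardSol_eq_iInf hs]
  exact iInf_le _ y

/-! ### Ordering of the backward and forward solutions -/

/-- Here e₀ = e^{φ₀} and e₁ = e^{-φ₁}, the value 0 standing for infinite potentials. After clearing
denominators, the difference of the two sides is the square (s e₀ sin β - (1-s) e₁ sin α)² plus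
s(1-s) times the slack in `key`. The latter is the squared form of cos α cos β ≤ e₀e₁ + sin α sin β.
-/
lemma weight_duality_of_real {s c₀ c₁ e₀ e₁ : ℝ} (hs : s ∈ Ioo (0 : ℝ) 1) {α β : ℝ}
    (hc₀ : c₀ = Real.cos α ^ 2) (hc₁ : c₁ = Real.cos β ^ 2)
    (hα : α ∈ Icc 0 (Real.pi / 2)) (hβ : β ∈ Icc 0 (Real.pi / 2)) (he₀ : 0 ≤ e₀) (he₁ : 0 ≤ e₁)
    (h : α + β < Real.pi / 2 → Real.cos (α + β) ≤ e₀ * e₁) :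
    s * (c₁ * (s + (1 - s) * e₁ ^ 2)⁻¹) + (1 - s) * (c₀ * (1 - s + s * e₀ ^ 2)⁻¹) ≤ 1 := by
  have hs0 := hs.1
  have hs1 : 0 < 1 - s := by linarith [hs.2]
  have h' : Real.cos (α + β) ≤ e₀ * e₁ := by
    rcases lt_or_ge (α + β) (Real.pi / 2) with h1 | h1
    · exact h h1
    · exact (Real.cos_nonpos_of_pi_div_two_le_of_le h1
        (by linarith [hα.2, hβ.2, Real.pi_pos])).trans (by positivity)
  rw [Real.cos_add] at h'
  have hsα : 0 ≤ Real.sin α :=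
    Real.sin_nonneg_of_nonneg_of_le_pi hα.1 (by linarith [hα.2, Real.pi_pos])
  have hsβ : 0 ≤ Real.sin β :=
    Real.sin_nonneg_of_nonneg_of_le_pi hβ.1 (by linarith [hβ.2, Real.pi_pos])
  have hcα : 0 ≤ Real.cos α :=
    Real.cos_nonneg_of_neg_pi_div_two_le_of_le
      (by linarith [hα.1, Real.pi_pos]) hα.2
  have hcβ : 0 ≤ Real.cos β :=
    Real.cos_nonneg_of_neg_pi_div_two_le_of_le
      (by linarith [hβ.1, Real.pi_pos]) hβ.2
  have hA : 0 < s + (1 - s) * e₁ ^ 2 := by positivity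
  have hB : 0 < 1 - s + s * e₀ ^ 2 := by positivity
  rw [← div_eq_mul_inv, ← div_eq_mul_inv, ← mul_div_assoc, ← mul_div_assoc,
    div_add_div _ _ hA.ne' hB.ne', div_le_one (by positivity)]
  have e₀' : c₀ = 1 - Real.sin α ^ 2 := by rw [hc₀, Real.cos_sq']
  have e₁' : c₁ = 1 - Real.sin β ^ 2 := by rw [hc₁, Real.cos_sq']
  have key : 1 ≤ e₀ ^ 2 * e₁ ^ 2 + 2 * (e₀ * e₁ * (Real.sin α * Real.sin β))
      + Real.sin α ^ 2 + Real.sin β ^ 2 := by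
    have h1 : Real.cos α * Real.cos β ≤ e₀ * e₁ + Real.sin α * Real.sin β := by linarith
    have h2 : (Real.cos α * Real.cos β) ^ 2 ≤ (e₀ * e₁ + Real.sin α * Real.sin β) ^ 2 := by gcongr
    rw [mul_pow, Real.cos_sq', Real.cos_sq'] at h2
    nlinarith
  have hsq := sq_nonneg (s * e₀ * Real.sin β - (1 - s) * e₁ * Real.sin α)
  have hkey := mul_le_mul_of_nonneg_left key (mul_pos hs0 hs1).le
  rw [e₀', e₁']
  nlinarith

lemma cos_sq_le_of_le_cost {φ₀ φ₁ : Eu d → EReal} {y₀ y₁ : Eu d} {a b : ℝ}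
    (h : φ₁ y₁ ≤ cost (y₁ - y₀) + φ₀ y₀) (ha : φ₀ y₀ = a) (hb : φ₁ y₁ = b)
    (hd : ‖y₁ - y₀‖ < Real.pi / 2) :
    Real.cos ‖y₁ - y₀‖ ≤ Real.exp a * Real.exp (-b) := by
  have hc : 0 < Real.cos ‖y₁ - y₀‖ :=
    Real.cos_pos_of_mem_Ioo ⟨by linarith [norm_nonneg (y₁ - y₀), Real.pi_pos], hd⟩
  rw [cost, if_pos hd, ha, hb] at h
  norm_cast at h
  have ht : 1 + Real.tan ‖y₁ - y₀‖ ^ 2 = (Real.cos ‖y₁ - y₀‖ ^ 2)⁻¹ :=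
    (Real.inv_one_add_tan_sq hc.ne' ▸ (inv_inv _).symm)
  rw [ht, Real.log_inv, Real.log_pow] at h
  push_cast at h
  rw [← Real.exp_add, ← Real.log_le_iff_le_exp hc]
  linarith

/-- The duality inequality behind the ordering of the backward and the forward solutions. -/
lemma weight_duality {φ₀ φ₁ : Eu d → EReal} {s : ℝ} (hs : s ∈ Ioo (0 : ℝ) 1)
    (h : ∀ x₀ x₁ : Eu d, ‖x₀ - x₁‖ < Real.pi / 2 → φ₁ x₁ ≤ cost (x₁ - x₀) + φ₀ x₀)
    (x y₀ y₁ : Eu d) :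
    s * (cosSq (x - y₁) * weight (1 - s) (-φ₁ y₁)) + (1 - s) * (cosSq (x - y₀) * weight s (φ₀ y₀))
      ≤ 1 := by
  have hs0 := hs.1
  have hs1 : 0 < 1 - s := by linarith [hs.2]
  have hs' : 1 - s ∈ Ioo (0 : ℝ) 1 := ⟨hs1, by linarith⟩
  have hw0 : (1 - s) * (cosSq (x - y₀) * weight s (φ₀ y₀)) ≤ 1 := by
    have : cosSq (x - y₀) * weight s (φ₀ y₀) ≤ 1 * (1 - s)⁻¹ :=
      mul_le_mul (cosSq_le_one _) (weight_le hs _) (weight_nonneg _ _) zero_le_one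
    calc _ ≤ (1 - s) * (1 * (1 - s)⁻¹) := by gcongr
      _ = 1 := by field_simp
  have hw1 : s * (cosSq (x - y₁) * weight (1 - s) (-φ₁ y₁)) ≤ 1 := by
    have : cosSq (x - y₁) * weight (1 - s) (-φ₁ y₁) ≤ 1 * (1 - (1 - s))⁻¹ :=
      mul_le_mul (cosSq_le_one _) (weight_le hs' _) (weight_nonneg _ _) zero_le_one
    calc _ ≤ s * (1 * (1 - (1 - s))⁻¹) := by gcongr
      _ = 1 := by rw [sub_sub_cancel]; field_simp
  rcases eq_or_ne (φ₀ y₀) ⊤ with h0 | h0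
  · rw [h0, weight_top hs.1]; simpa using hw1
  rcases eq_or_ne (φ₁ y₁) ⊥ with h1 | h1
  · rw [h1, EReal.neg_bot, weight_top hs1]; simpa using hw0
  set α := min ‖x - y₀‖ (Real.pi / 2) with hα
  set β := min ‖x - y₁‖ (Real.pi / 2) with hβ
  have hα' : α ∈ Icc 0 (Real.pi / 2) := ⟨le_min (norm_nonneg _) (by positivity), min_le_right _ _⟩
  have hβ' : β ∈ Icc 0 (Real.pi / 2) := ⟨le_min (norm_nonneg _) (by positivity), min_le_right _ _⟩
  -- If α + β < π/2, neither distance is truncated, so the triangle inequality applies and the pair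
  -- lies in the range of the cost constraint.
  have hdist : α + β < Real.pi / 2 → ‖y₁ - y₀‖ ≤ α + β := by
    intro hlt
    have e0 : α = ‖x - y₀‖ := by
      rcases min_choice ‖x - y₀‖ (Real.pi / 2) with h | h
      · rw [hα, h]
      · linarith [hβ'.1, hα.trans h]
    have e1 : β = ‖x - y₁‖ := by
      rcases min_choice ‖x - y₁‖ (Real.pi / 2) with h | h
      · rw [hβ, h]
      · linarith [hα'.1, hβ.trans h]
    rw [e0, e1, show y₁ - y₀ = (x - y₀) - (x - y₁) by abel]
    exact norm_sub_le _ _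
  have hcos : α + β < Real.pi / 2 → Real.cos (α + β) ≤ Real.cos ‖y₁ - y₀‖ := fun hlt =>
    Real.cos_le_cos_of_nonneg_of_le_pi (norm_nonneg _) (by linarith [Real.pi_pos]) (hdist hlt)
  have hcpos : α + β < Real.pi / 2 → 0 < Real.cos (α + β) := fun hlt =>
    Real.cos_pos_of_mem_Ioo ⟨by linarith [hα'.1, hβ'.1, Real.pi_pos], hlt⟩
  have hle : α + β < Real.pi / 2 → φ₁ y₁ ≤ cost (y₁ - y₀) + φ₀ y₀ := fun hlt =>
    h y₀ y₁ (by rw [norm_sub_rev]; exact (hdist hlt).trans_lt hlt)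
  have hcost : α + β < Real.pi / 2 → cost (y₁ - y₀) ≠ ⊤ := fun hlt => by
    rw [cost, if_pos ((hdist hlt).trans_lt hlt)]
    exact EReal.coe_ne_top _
  have main : ∀ e₀ e₁ : ℝ, 0 ≤ e₀ → 0 ≤ e₁ →
      weight s (φ₀ y₀) = (1 - s + s * e₀ ^ 2)⁻¹ →
      weight (1 - s) (-φ₁ y₁) = (s + (1 - s) * e₁ ^ 2)⁻¹ →
      (α + β < Real.pi / 2 → Real.cos (α + β) ≤ e₀ * e₁) →
      s * (cosSq (x - y₁) * weight (1 - s) (-φ₁ y₁)) +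
        (1 - s) * (cosSq (x - y₀) * weight s (φ₀ y₀)) ≤ 1 := by
    intro e₀ e₁ he₀ he₁ hw₀ hw₁ hc
    rw [hw₀, hw₁]
    exact weight_duality_of_real hs rfl rfl hα' hβ' he₀ he₁ hc
  have wcoe0 : ∀ a : ℝ, φ₀ y₀ = a → weight s (φ₀ y₀) = (1 - s + s * Real.exp a ^ 2)⁻¹ := by
    intro a ha
    rw [ha, weight_coe hs, ← Real.exp_nat_mul]
    norm_num
  have wcoe1 : ∀ b : ℝ, φ₁ y₁ = b →
      weight (1 - s) (-φ₁ y₁) = (s + (1 - s) * Real.exp (-b) ^ 2)⁻¹ := by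
    intro b hb
    rw [hb, ← EReal.coe_neg, weight_coe hs', ← Real.exp_nat_mul]
    norm_num
  have wbot0 : φ₀ y₀ = ⊥ → weight s (φ₀ y₀) = (1 - s + s * 0 ^ 2)⁻¹ := by
    intro ha
    rw [ha, weight_bot hs.2]; simp
  have wtop1 : φ₁ y₁ = ⊤ → weight (1 - s) (-φ₁ y₁) = (s + (1 - s) * 0 ^ 2)⁻¹ := by
    intro ha
    rw [ha, EReal.neg_top, weight_bot hs'.2]; simp
  by_cases h2 : φ₀ y₀ = ⊥
  · have hno : ¬ (α + β < Real.pi / 2) := fun hlt => by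
      have := hle hlt
      rw [h2, EReal.add_bot] at this
      exact h1 (le_bot_iff.1 this)
    by_cases h3 : φ₁ y₁ = ⊤
    · exact main 0 0 le_rfl le_rfl (wbot0 h2) (wtop1 h3) fun hlt => absurd hlt hno
    · exact main 0 _ le_rfl (Real.exp_pos _).le (wbot0 h2)
        (wcoe1 _ (EReal.coe_toReal h3 h1).symm) fun hlt => absurd hlt hno
  · by_cases h3 : φ₁ y₁ = ⊤
    · refine main _ 0 (Real.exp_pos _).le le_rfl (wcoe0 _ (EReal.coe_toReal h0 h2).symm)
        (wtop1 h3) fun hlt => ?_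
      have := hle hlt
      rw [h3, top_le_iff] at this
      exact absurd this (EReal.add_ne_top (hcost hlt) h0)
    · exact main _ _ (Real.exp_pos _).le (Real.exp_pos _).le
        (wcoe0 _ (EReal.coe_toReal h0 h2).symm) (wcoe1 _ (EReal.coe_toReal h3 h1).symm)
        fun hlt => (hcos hlt).trans (cos_sq_le_of_le_cost (hle hlt)
          (EReal.coe_toReal h0 h2).symm (EReal.coe_toReal h3 h1).symm ((hdist hlt).trans_lt hlt))

/-- `f` is touched from below at `x` by the function `z ↦ -(1 - κ cos² |z - y|) / (2 τ)`. -/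
def TouchedBelow (τ κ : ℝ) (y : Eu d) (f : Eu d → ℝ) (x : Eu d) : Prop :=
  (∀ z, -(1 / (2 * τ) * (1 - κ * cosSq (z - y))) ≤ f z) ∧
    f x = -(1 / (2 * τ) * (1 - κ * cosSq (x - y)))

/-- The minimiser in the Hopf–Lax formula at x gives a competitor that lies above ξ_s everywhere and
agrees with it at x. This works at every x. -/
lemma exists_touchedBelow_neg_pot {φ : Eu d → EReal} (hφ : LowerSemicontinuous φ) {s : ℝ}
    (hs : s ∈ Ioo (0 : ℝ) 1) (x : Eu d) :
    ∃ κ ∈ Icc 0 (1 - s)⁻¹, ∃ y, TouchedBelow s κ y (fun z => -pot φ s z) x := by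
  obtain ⟨y, hy⟩ := exists_pot_eq hs hφ x
  refine ⟨weight s (φ y), ⟨weight_nonneg _ _, weight_le hs _⟩, y, fun z => ?_, ?_⟩
  · have := pot_le hs hφ z y
    rw [mul_comm (weight _ _)]
    linarith
  · simp only [hy, mul_comm (weight _ _)]

/-- The optimal competitor of the backward solution at x lies below the forward solution everywhere,
by duality, and meets it at x because x is a contact point. -/
lemma exists_touchedBelow_pot {φ₀ φ₁ : Eu d → EReal} (hφ₀ : LowerSemicontinuous φ₀)
    (hφ₁ : UpperSemicontinuous φ₁)
    (h : ∀ x₀ x₁ : Eu d, ‖x₀ - x₁‖ < Real.pi / 2 → φ₁ x₁ ≤ cost (x₁ - x₀) + φ₀ x₀)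
    {s : ℝ} (hs : s ∈ Ioo (0 : ℝ) 1) {x : Eu d} (hx : x ∈ contactSet φ₀ φ₁ s) :
    ∃ κ ∈ Icc 0 s⁻¹, ∃ y, TouchedBelow (1 - s) κ y (pot φ₀ s) x := by
  have hs0 := hs.1
  have hs1 : 0 < 1 - s := by linarith [hs.2]
  have hs' : 1 - s ∈ Ioo (0 : ℝ) 1 := ⟨hs1, by linarith⟩
  have hψ : LowerSemicontinuous fun y => -φ₁ y :=
    continuous_neg.comp_upperSemicontinuous_antitone hφ₁ fun a b h => EReal.neg_le_neg_iff.2 h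
  obtain ⟨y, hy⟩ := exists_pot_eq hs' hψ x
  refine ⟨weight (1 - s) (-φ₁ y), ⟨weight_nonneg _ _, ?_⟩, y, fun z => ?_, ?_⟩
  · simpa using weight_le hs' (-φ₁ y)
  · obtain ⟨y₀, hy₀⟩ := exists_pot_eq hs hφ₀ z
    have := weight_duality hs h z y₀ y
    rw [hy₀, neg_le_iff_add_nonneg]
    have e : 1 / (2 * s) * (1 - cosSq (z - y₀) * weight s (φ₀ y₀)) +
        1 / (2 * (1 - s)) * (1 - weight (1 - s) (-φ₁ y) * cosSq (z - y)) =
        (1 - (s * (cosSq (z - y) * weight (1 - s) (-φ₁ y)) +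
          (1 - s) * (cosSq (z - y₀) * weight s (φ₀ y₀)))) / (2 * s * (1 - s)) := by
      field_simp
      ring
    rw [e]
    exact div_nonneg (by linarith) (by positivity)
  · have hx' : backwardSol φ₁ s x = forwardSol φ₀ s x := hx
    rw [backwardSol_eq, ← coe_pot hs' hψ, ← coe_pot hs hφ₀, ← EReal.coe_neg,
      EReal.coe_eq_coe_iff] at hx'
    rw [← hx', hy, mul_comm (weight _ _)]

/-! ### First-order information at touching points -/

lemma hasFDerivAt_of_quadratic_bound {f : Eu d → ℝ} {L : Eu d →L[ℝ] ℝ} {x : Eu d} {C : ℝ}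
    (h : ∀ z, |f z - f x - L (z - x)| ≤ C * ‖z - x‖ ^ 2) : HasFDerivAt f L x := by
  refine .of_isLittleO ?_
  have h1 : (fun z => f z - f x - L (z - x)) =O[𝓝 x] fun z => ‖z - x‖ ^ 2 :=
    Asymptotics.IsBigO.of_bound C (Eventually.of_forall fun z => by simpa using h z)
  refine h1.trans_isLittleO ?_
  have h2 : Tendsto (fun z : Eu d => z - x) (𝓝 x) (𝓝 0) :=
    tendsto_sub_nhds_zero_iff.2 tendsto_id
  exact (Asymptotics.isLittleO_norm_pow_id (E' := Eu d) one_lt_two).comp_tendsto h2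

lemma TouchedBelow.add_ge {τ κ : ℝ} {y x : Eu d} {f : Eu d → ℝ} (hf : TouchedBelow τ κ y f x)
    (hτ : 0 < τ) (hκ : 0 ≤ κ) (h : Eu d) :
    f x + inner ℝ ((κ / (2 * τ)) • cosSqGrad (x - y)) h - κ / (2 * τ) * ‖h‖ ^ 2 ≤ f (x + h) := by
  have h1 := hf.1 (x + h)
  have h2 := cosSq_add_ge (x - y) h
  rw [show x - y + h = x + h - y by abel] at h2
  rw [hf.2, real_inner_smul_left]
  have h3 := mul_le_mul_of_nonneg_left h2 (by positivity : 0 ≤ κ / (2 * τ))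
  have e : ∀ b : ℝ, 1 / (2 * τ) * (1 - κ * b) = 1 / (2 * τ) - κ / (2 * τ) * b := fun b => by ring
  rw [e] at h1 ⊢
  linarith

lemma eq_zero_of_inner_le {v : Eu d} {C : ℝ} (h : ∀ w, inner ℝ v w ≤ C * ‖w‖ ^ 2) : v = 0 := by
  by_contra hv
  have hpos : 0 < ‖v‖ ^ 2 := by have := norm_pos_iff.2 hv; positivity
  -- At a small multiple of v the linear term dominates the quadratic one; this step size makes the
  -- quadratic side at most half of the linear side.
  have h1 := h ((1 / (2 * (|C| + 1))) • v)
  rw [real_inner_smul_right, real_inner_self_eq_norm_sq, norm_smul, mul_pow, Real.norm_eq_abs,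
    sq_abs] at h1
  set t := 1 / (2 * (|C| + 1)) with ht
  have ht0 : 0 < t := by positivity
  have h2 : C * (t ^ 2 * ‖v‖ ^ 2) ≤ (|C| + 1) * (t ^ 2 * ‖v‖ ^ 2) := by
    gcongr; linarith [le_abs_self C]
  have h3 : (|C| + 1) * t = 1 / 2 := by rw [ht]; field_simp
  have h4 : (|C| + 1) * (t ^ 2 * ‖v‖ ^ 2) = 1 / 2 * (t * ‖v‖ ^ 2) := by rw [← h3]; ring
  have : 0 < t * ‖v‖ ^ 2 := by positivity
  linarith

/-- A function touched from both sides is differentiable, with a quadratic remainder. -/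
lemma quadratic_bound_of_touched {τ₀ τ₁ κ₀ κ₁ C : ℝ} {y₀ y₁ x : Eu d} {f : Eu d → ℝ}
    (h₁ : TouchedBelow τ₁ κ₁ y₁ f x) (h₀ : TouchedBelow τ₀ κ₀ y₀ (fun z => -f z) x)
    (hτ₁ : 0 < τ₁) (hτ₀ : 0 < τ₀) (hκ₁ : 0 ≤ κ₁) (hκ₀ : 0 ≤ κ₀)
    (hC₁ : κ₁ / (2 * τ₁) ≤ C) (hC₀ : κ₀ / (2 * τ₀) ≤ C) :
    gradient f x = (κ₁ / (2 * τ₁)) • cosSqGrad (x - y₁) ∧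
    gradient f x = -((κ₀ / (2 * τ₀)) • cosSqGrad (x - y₀)) ∧
    HasGradientAt f (gradient f x) x ∧
    ∀ z, |f z - f x - inner ℝ (gradient f x) (z - x)| ≤ C * ‖z - x‖ ^ 2 := by
  set q₁ := (κ₁ / (2 * τ₁)) • cosSqGrad (x - y₁)
  set q₀ := (κ₀ / (2 * τ₀)) • cosSqGrad (x - y₀)
  have l₁ : ∀ h, f x + inner ℝ q₁ h - C * ‖h‖ ^ 2 ≤ f (x + h) := fun h =>
    le_trans (by gcongr) (h₁.add_ge hτ₁ hκ₁ h)
  have l₀ : ∀ h, -f x + inner ℝ q₀ h - C * ‖h‖ ^ 2 ≤ -f (x + h) := fun h =>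
    le_trans (by gcongr) (h₀.add_ge hτ₀ hκ₀ h)
  have hq : q₁ = -q₀ := by
    refine eq_neg_of_add_eq_zero_left (eq_zero_of_inner_le (C := 2 * C) fun w => ?_)
    rw [inner_add_left]
    linarith [l₁ w, l₀ w]
  have hb : ∀ z, |f z - f x - inner ℝ q₁ (z - x)| ≤ C * ‖z - x‖ ^ 2 := by
    intro z
    have h1 := l₁ (z - x)
    have h2 := l₀ (z - x)
    rw [add_sub_cancel] at h1 h2
    have h3 : inner ℝ q₀ (z - x) = -inner ℝ q₁ (z - x) := by rw [hq, inner_neg_left, neg_neg]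
    exact abs_le.2 ⟨by linarith, by linarith⟩
  have hgrad : HasGradientAt f q₁ x := by
    rw [hasGradientAt_iff_hasFDerivAt]
    exact hasFDerivAt_of_quadratic_bound (C := C) fun z => by
      simpa [InnerProductSpace.toDual_apply_apply] using hb z
  rw [hgrad.gradient]
  exact ⟨rfl, hq, hgrad, hb⟩

/-! ### Density points and second-order information -/

/-- Every direction is approximated by points of the blow-ups of `S` at `x`. -/
def FullTangent (S : Set (Eu d)) (x : Eu d) : Prop :=
  ∀ w : Eu d, ∀ ε > 0, ∀ᶠ r in 𝓝[>] (0 : ℝ), ∃ w' ∈ Metric.ball w ε, x + r • w' ∈ S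

/-- A ball around w keeps a fixed share of volume under scaling, so a set of density one must meet
its small copies at x. Spheres are null, so densities over open and closed balls coincide. -/
lemma IsDensityPoint.fullTangent (hd : 1 ≤ d) {S : Set (Eu d)} {x : Eu d}
    (h : IsDensityPoint S x) : FullTangent S x := by
  intro w ε hε
  have : Nonempty (Fin d) := ⟨⟨0, hd⟩⟩
  have h' : Tendsto (fun r => volume (S ∩ Metric.closedBall x r) / volume (Metric.closedBall x r))
      (𝓝[>] 0) (𝓝 1) := by
    refine h.congr' ?_
    filter_upwards [self_mem_nhdsWithin] with r hr
    have hr : 0 < r := hr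
    rw [Measure.addHaar_closedBall_eq_addHaar_ball]
    congr 1
    refine le_antisymm (measure_mono (inter_subset_inter_right _ Metric.ball_subset_closedBall)) ?_
    calc volume (S ∩ Metric.closedBall x r)
        ≤ volume ((S ∩ Metric.ball x r) ∪ Metric.sphere x r) := by
          refine measure_mono fun z hz => ?_
          rcases (Metric.mem_closedBall.1 hz.2).lt_or_eq with h1 | h1
          · exact Or.inl ⟨hz.1, h1⟩
          · exact Or.inr h1
      _ ≤ volume (S ∩ Metric.ball x r) + volume (Metric.sphere x r) := measure_union_le _ _
      _ = volume (S ∩ Metric.ball x r) := by rw [Measure.addHaar_sphere_of_ne_zero _ _ hr.ne', add_zero]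
  filter_upwards [Measure.eventually_nonempty_inter_smul_of_density_one volume S x h'
    (Metric.ball w ε) measurableSet_ball (Metric.measure_ball_pos _ _ hε).ne'] with r hr
  obtain ⟨z, hz, hz'⟩ := hr
  rw [singleton_add, mem_image] at hz'
  obtain ⟨b, ⟨w', hw', rfl⟩, rfl⟩ := hz'
  exact ⟨w', hw', hz⟩

lemma FullTangent.exists_selection {S : Set (Eu d)} {x : Eu d} (h : FullTangent S x)
    (hx : x ∈ S) (w : Eu d) :
    ∃ W : ℝ → Eu d, (∀ r, x + r • W r ∈ S) ∧ Tendsto W (𝓝[>] 0) (𝓝 w) := by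
  have hne : ∀ r : ℝ, {w' : Eu d | x + r • w' ∈ S}.Nonempty := fun r => ⟨0, by simpa using hx⟩
  -- W r is taken in the blow-up (S - x)/r, within |r| of the infimal distance to w, which
  -- `FullTangent` sends to 0.
  have hsel : ∀ r : ℝ, ∃ w' ∈ {w' : Eu d | x + r • w' ∈ S},
      dist w w' < Metric.infDist w {w' : Eu d | x + r • w' ∈ S} + |r| ∨ r = 0 := by
    intro r
    by_cases hr : r = 0
    · obtain ⟨w', hw'⟩ := hne r
      exact ⟨w', hw', Or.inr hr⟩
    · obtain ⟨w', hw', h1⟩ := (Metric.infDist_lt_iff (hne r)).1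
        (lt_add_of_pos_right (Metric.infDist w {w' : Eu d | x + r • w' ∈ S}) (abs_pos.2 hr))
      exact ⟨w', hw', Or.inl h1⟩
  choose W hW hW' using hsel
  refine ⟨W, hW, Metric.tendsto_nhds.2 fun ε hε => ?_⟩
  have hsmall : ∀ᶠ r in 𝓝[>] (0 : ℝ), |r| < ε / 2 :=
    nhdsWithin_le_nhds (eventually_abs_sub_lt 0 (half_pos hε) |>.mono fun r hr => by simpa using hr)
  filter_upwards [h w (ε / 2) (half_pos hε), hsmall, self_mem_nhdsWithin] with r h1 h2 h3
  obtain ⟨w', hw', hw''⟩ := h1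
  have h4 : Metric.infDist w {w' : Eu d | x + r • w' ∈ S} ≤ dist w w' :=
    Metric.infDist_le_dist_of_mem hw''
  rw [Metric.mem_ball, dist_comm] at hw'
  rcases hW' r with h5 | h5
  · rw [dist_comm]; linarith
  · exact absurd h5 (ne_of_gt h3)

lemma FullTangent.uniqueDiffWithinAt {S : Set (Eu d)} {x : Eu d} (h : FullTangent S x)
    (hx : x ∈ S) : UniqueDiffWithinAt ℝ S x := by
  refine ⟨?_, subset_closure hx⟩
  have : tangentConeAt ℝ S x = univ := by
    refine eq_univ_of_forall fun w => ?_
    obtain ⟨W, hW, hlim⟩ := h.exists_selection hx w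
    have hid : Tendsto (fun r : ℝ => r) (𝓝[>] 0) (𝓝 0) := tendsto_id.mono_left nhdsWithin_le_nhds
    refine mem_tangentConeAt_of_seq (𝓝[>] (0 : ℝ)) (fun r => r⁻¹) (fun r => r • W r) ?_
      (Eventually.of_forall hW) ?_
    · simpa using hid.smul hlim
    · refine hlim.congr' ?_
      filter_upwards [self_mem_nhdsWithin] with r hr
      rw [smul_smul, inv_mul_cancel₀ (ne_of_gt hr), one_smul]
  rw [this]
  simp

/-- Second-order expansion along a set, at a point at which the gradient is differentiable
along the set. -/
lemma second_order_expansion {S : Set (Eu d)} {x : Eu d} (hS : FullTangent S x) (hx : x ∈ S)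
    {f : Eu d → ℝ} {G : Eu d → Eu d} {C : ℝ} (hC : 0 ≤ C)
    (hb : ∀ y ∈ S, ∀ z, |f z - f y - inner ℝ (G y) (z - y)| ≤ C * ‖z - y‖ ^ 2)
    {H : Eu d →L[ℝ] Eu d} (hH : HasFDerivWithinAt G H S x) :
    (∀ v w, inner ℝ (H v) w = inner ℝ (H w) v) ∧
    ∀ w, ∃ l : Filter ℝ, l.NeBot ∧ l ≤ 𝓝[>] 0 ∧ ∃ W : ℝ → Eu d, Tendsto W l (𝓝 w) ∧
      Tendsto (fun r => (f (x + r • W r) - f x - r * inner ℝ (G x) (W r)) / r ^ 2) l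
        (𝓝 (inner ℝ (H w) w / 2)) := by
  choose W hWS hW using fun w => hS.exists_selection hx w
  set F : Eu d → ℝ → ℝ := fun w r =>
    (f (x + r • W w r) - f x - r * inner ℝ (G x) (W w r)) / r ^ 2 with hF
  -- The rescaled remainders are bounded for each direction w; one ultrafilter makes them converge
  -- for all w simultaneously, without extracting subsequences.
  let 𝒰 : Ultrafilter ℝ := Ultrafilter.of (𝓝[>] 0)
  have hU : (𝒰 : Filter ℝ) ≤ 𝓝[>] 0 := Ultrafilter.of_le _
  have hpos : ∀ᶠ r in (𝒰 : Filter ℝ), 0 < r := hU self_mem_nhdsWithin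
  have hbound : ∀ w, ∀ᶠ r in (𝒰 : Filter ℝ), |F w r| ≤ C * ‖W w r‖ ^ 2 := by
    intro w
    filter_upwards [hpos] with r hr
    have h1 := hb x hx (x + r • W w r)
    rw [add_sub_cancel_left, real_inner_smul_right, norm_smul, mul_pow, Real.norm_eq_abs,
      sq_abs] at h1
    rw [hF]
    simp only
    rw [abs_div, abs_of_pos (pow_pos hr 2), div_le_iff₀ (pow_pos hr 2)]
    linarith
  have hlim : ∀ w, ∃ g, Tendsto (F w) 𝒰 (𝓝 g) := by
    intro w
    have h1 : ∀ᶠ r in (𝒰 : Filter ℝ), F w r ∈ Icc (-(C * (‖w‖ + 1) ^ 2)) (C * (‖w‖ + 1) ^ 2) := by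
      have h2 : ∀ᶠ r in (𝒰 : Filter ℝ), ‖W w r‖ < ‖w‖ + 1 :=
        hU ((hW w).norm.eventually (gt_mem_nhds (lt_add_one _)))
      filter_upwards [hbound w, h2] with r h3 h4
      refine abs_le.1 (h3.trans ?_)
      gcongr
    obtain ⟨g, -, hg⟩ := isCompact_Icc.ultrafilter_le_nhds (𝒰.map (F w))
      (le_principal_iff.2 h1)
    exact ⟨g, hg⟩
  choose g hg using hlim
  have hquot : ∀ w, Tendsto (fun r : ℝ => r⁻¹ • (G (x + r • W w r) - G x)) 𝒰 (𝓝 (H w)) := by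
    intro w
    refine HasFDerivWithinAt.lim hH ?_ (Eventually.of_forall (hWS w)) ?_
    · simpa using ((tendsto_id.mono_left nhdsWithin_le_nhds).mono_left hU).smul
        ((hW w).mono_left hU)
    · refine ((hW w).mono_left hU).congr' ?_
      filter_upwards [hpos] with r hr
      rw [smul_smul, inv_mul_cancel₀ hr.ne', one_smul]
  -- The uniform remainder bound is used at base points x + r W(w) of S. In the limit, the blow-up g
  -- has derivative ⟨H w, ·⟩ at every w.
  have hgbound : ∀ w w', |g w' - g w - inner ℝ (H w) (w' - w)| ≤ C * ‖w' - w‖ ^ 2 := by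
    intro w w'
    have hsub := ((hW w').mono_left hU).sub ((hW w).mono_left hU)
    refine le_of_tendsto_of_tendsto (((hg w').sub (hg w)).sub ((hquot w).inner hsub)).abs
      ((hsub.norm.pow 2).const_mul C) ?_
    filter_upwards [hpos] with r hr
    have h1 := hb _ (hWS w r) (x + r • W w' r)
    rw [show x + r • W w' r - (x + r • W w r) = r • (W w' r - W w r) by rw [smul_sub]; abel,
      real_inner_smul_right, norm_smul, mul_pow, Real.norm_eq_abs, sq_abs] at h1
    have e : F w' r - F w r - inner ℝ (r⁻¹ • (G (x + r • W w r) - G x)) (W w' r - W w r)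
        = (f (x + r • W w' r) - f (x + r • W w r)
          - r * inner ℝ (G (x + r • W w r)) (W w' r - W w r)) / r ^ 2 := by
      simp only [hF, real_inner_smul_left, inner_sub_left, inner_sub_right]
      field_simp
      ring
    rw [e, abs_div, abs_of_pos (pow_pos hr 2), div_le_iff₀ (pow_pos hr 2)]
    linarith
  have hgd : ∀ w, HasFDerivAt g (innerSL ℝ (H w)) w := fun w =>
    hasFDerivAt_of_quadratic_bound (C := C) fun z => by simpa using hgbound w z
  let B : Eu d →L[ℝ] Eu d →L[ℝ] ℝ := LinearMap.toContinuousLinearMap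
    { toFun := fun w => innerSL ℝ (H w)
      map_add' := fun v w => by rw [map_add, map_add]
      map_smul' := fun c w => by rw [map_smul, map_smulₛₗ]; rfl }
  -- H is now the second derivative of a function differentiable on the whole space, hence
  -- symmetric.
  have hsymm : ∀ v w, inner ℝ (H v) w = inner ℝ (H w) v := fun v w => by
    have := second_derivative_symmetric (f'' := B) hgd
      (B.hasFDerivAt (x := (0 : Eu d))) v w
    simpa [B] using this
  have hg0 : g 0 = 0 := by
    have h1 : Tendsto (F 0) 𝒰 (𝓝 0) := by
      refine squeeze_zero_norm' (hbound 0) ?_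
      have := (((hW 0).mono_left hU).norm.pow 2).const_mul C
      simpa using this
    exact tendsto_nhds_unique (hg 0) h1
  have hgH : ∀ w, g w = inner ℝ (H w) w / 2 := by
    set k : Eu d → ℝ := fun w => g w - inner ℝ (H w) w / 2 with hk
    have hkd : ∀ w, HasFDerivAt k (0 : Eu d →L[ℝ] ℝ) w := fun w =>
      hasFDerivAt_of_quadratic_bound (C := C + ‖H‖ / 2) fun z => by
        have e : k z - k w - (0 : Eu d →L[ℝ] ℝ) (z - w)
            = (g z - g w - inner ℝ (H w) (z - w)) - inner ℝ (H (z - w)) (z - w) / 2 := by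
          simp only [hk, map_sub, inner_sub_left, inner_sub_right]
          rw [hsymm z w]
          simp
          ring
        rw [e]
        refine (abs_sub _ _).trans ?_
        have h1 : |inner ℝ (H (z - w)) (z - w) / 2| ≤ ‖H‖ / 2 * ‖z - w‖ ^ 2 := by
          rw [abs_div, abs_of_pos (by norm_num : (0 : ℝ) < 2)]
          have := (abs_real_inner_le_norm (H (z - w)) (z - w)).trans
            (mul_le_mul_of_nonneg_right (H.le_opNorm (z - w)) (norm_nonneg _))
          linarith
        linarith [hgbound w z]
    have hconst := is_const_of_fderiv_eq_zero (fun w => (hkd w).differentiableAt)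
      (fun w => (hkd w).fderiv)
    intro w
    have := hconst w 0
    simp only [hk, hg0, map_zero, inner_zero_left] at this
    linarith
  refine ⟨hsymm, fun w => ⟨𝒰, inferInstance, hU, W w, (hW w).mono_left hU, ?_⟩⟩
  rw [← hgH]
  exact hg w

/-- A lower second-order Taylor estimate bounds the differential of the gradient from below. -/
lemma quadForm_le_of_lower_taylor {S : Set (Eu d)} {x : Eu d} (hS : FullTangent S x) (hx : x ∈ S)
    {f : Eu d → ℝ} {G : Eu d → Eu d} {C : ℝ} (hC : 0 ≤ C)
    (hb : ∀ y ∈ S, ∀ z, |f z - f y - inner ℝ (G y) (z - y)| ≤ C * ‖z - y‖ ^ 2)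
    {H : Eu d →L[ℝ] Eu d} (hH : HasFDerivWithinAt G H S x)
    {Q : Eu d → ℝ} (hQ : Continuous Q) (hQ2 : ∀ (r : ℝ) w, Q (r • w) = r ^ 2 * Q w) {C' : ℝ}
    (hf : ∀ᶠ h in 𝓝 (0 : Eu d),
      f x + inner ℝ (G x) h + Q h / 2 - C' * ‖h‖ ^ 3 ≤ f (x + h)) (w : Eu d) :
    Q w ≤ inner ℝ (H w) w := by
  obtain ⟨-, h2⟩ := second_order_expansion hS hx hC hb hH
  obtain ⟨l, hl, hl0, W, hW, hlim⟩ := h2 w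
  have hid : Tendsto (fun r : ℝ => r) l (𝓝 0) :=
    tendsto_id.mono_left (hl0.trans nhdsWithin_le_nhds)
  have hz : Tendsto (fun r : ℝ => r • W r) l (𝓝 0) := by simpa using hid.smul hW
  have h3 : Tendsto (fun r => Q (W r) / 2 - C' * (r * ‖W r‖ ^ 3)) l (𝓝 (Q w / 2)) := by
    have := (((hQ.tendsto w).comp hW).div_const 2).sub ((hid.mul (hW.norm.pow 3)).const_mul C')
    simpa using this
  have h4 := le_of_tendsto_of_tendsto h3 hlim (by
    filter_upwards [hz.eventually hf, hl0 self_mem_nhdsWithin] with r h5 h6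
    have h6 : 0 < r := h6
    rw [hQ2, real_inner_smul_right, norm_smul, mul_pow, Real.norm_eq_abs, abs_of_pos h6] at h5
    rw [le_div_iff₀ (pow_pos h6 2)]
    nlinarith)
  linarith

/-! ### The angular time change -/

/-- The speed of the angular time change: `|p|`, or `1` if `p = 0`. -/
noncomputable def speed (p : Eu d) : ℝ := if p = 0 then 1 else ‖p‖

/-- The normalised direction of the gradient, or `0` if `p = 0`. -/
noncomputable def dir (p : Eu d) : Eu d := (speed p)⁻¹ • p

/-- The angular time: `arctan (τ |p| / a)`, or `τ / a` if `p = 0`, where `a = 1 + 2 τ f`. -/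
noncomputable def angle (f : ℝ) (p : Eu d) (τ : ℝ) : ℝ :=
  if p = 0 then τ / (1 + 2 * τ * f) else Real.arctan (τ * ‖p‖ / (1 + 2 * τ * f))

lemma speed_of_ne {p : Eu d} (hp : p ≠ 0) : speed p = ‖p‖ := if_neg hp

lemma norm_dir_of_ne {p : Eu d} (hp : p ≠ 0) : ‖dir p‖ = 1 := by
  rw [dir, speed_of_ne hp, norm_smul, norm_inv, norm_norm, inv_mul_cancel₀ (norm_ne_zero_iff.2 hp)]

lemma dir_zero : dir (0 : Eu d) = 0 := by rw [dir, smul_zero]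

lemma norm_dir_sq_mul_speed_sq (p : Eu d) : ‖dir p‖ ^ 2 * speed p ^ 2 = ‖p‖ ^ 2 := by
  by_cases hp : p = 0
  · simp [hp, dir_zero]
  · rw [norm_dir_of_ne hp, speed_of_ne hp]; ring

lemma inner_dir_sq_le (p w : Eu d) : (inner ℝ (dir p) w) ^ 2 ≤ ‖w‖ ^ 2 := by
  by_cases hp : p = 0
  · simp [hp, dir_zero]
  · have := abs_real_inner_le_norm (dir p) w
    rw [norm_dir_of_ne hp, one_mul] at this
    rw [← sq_abs]; gcongr

lemma speed_neg (p : Eu d) : speed (-p) = speed p := by simp [speed]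

lemma dir_neg (p : Eu d) : dir (-p) = -dir p := by simp [dir, speed_neg]

lemma angle_neg (f : ℝ) (p : Eu d) (τ : ℝ) : angle (-f) (-p) (-τ) = -angle f p τ := by
  simp only [angle, neg_eq_zero, norm_neg]
  rw [show 1 + 2 * -τ * -f = 1 + 2 * τ * f by ring, neg_mul, neg_div, neg_div, Real.arctan_neg]
  split_ifs <;> rfl

/-- The cotangent is strictly decreasing on (0, π): the cross difference is sin(B - A) > 0. -/
lemma cos_div_sin_lt {A B : ℝ} (hA : 0 < A) (hAB : A < B) (hB : B < Real.pi) :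
    Real.cos B / Real.sin B < Real.cos A / Real.sin A := by
  have h1 := Real.sin_pos_of_pos_of_lt_pi hA (hAB.trans hB)
  have h2 := Real.sin_pos_of_pos_of_lt_pi (hA.trans hAB) hB
  have h3 := Real.sin_pos_of_pos_of_lt_pi (sub_pos.2 hAB) (by linarith)
  rw [Real.sin_sub] at h3
  rw [div_lt_div_iff₀ h2 h1]
  linarith

lemma TouchedBelow.one_add_eq {τ κ : ℝ} {y x : Eu d} {f : Eu d → ℝ}
    (hf : TouchedBelow τ κ y f x) (hτ : 0 < τ) : 1 + 2 * τ * f x = κ * cosSq (x - y) := by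
  rw [hf.2]; field_simp; ring

/-- The expression is affine in t, equal to 1 at t = 0 and nonnegative at t = τ. -/
lemma TouchedBelow.one_add_pos {τ κ : ℝ} {y x : Eu d} {f : Eu d → ℝ}
    (hf : TouchedBelow τ κ y f x) (hκ : 0 ≤ κ) {t : ℝ} (ht : t ∈ Ioo 0 τ) :
    0 < 1 + 2 * t * f x := by
  have hτ := ht.1.trans ht.2
  have h1 := hf.one_add_eq hτ
  have h2 := mul_nonneg hκ (cosSq_nonneg (x - y))
  rcases le_total 0 (f x) with h | h
  · have := ht.1; positivity
  · rcases h.lt_or_eq with h | h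
    · nlinarith [ht.2]
    · rw [h]; norm_num

/-- The quadratic form governing the differential of the transport map is positive at positive
times before the touching time. -/
lemma TouchedBelow.quadForm_pos {S : Set (Eu d)} {x y : Eu d} (hS : FullTangent S x) (hx : x ∈ S)
    {f : Eu d → ℝ} {G : Eu d → Eu d} {C τ κ : ℝ} (hC : 0 ≤ C)
    (hb : ∀ y ∈ S, ∀ z, |f z - f y - inner ℝ (G y) (z - y)| ≤ C * ‖z - y‖ ^ 2)
    {H : Eu d →L[ℝ] Eu d} (hH : HasFDerivWithinAt G H S x)
    (hf : TouchedBelow τ κ y f x) (hκ : 0 ≤ κ) (hG : G x = (κ / (2 * τ)) • cosSqGrad (x - y))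
    {t : ℝ} (ht : t ∈ Ioo 0 τ) :
    0 < angle (f x) (G x) t ∧
    ∀ w : Eu d, w ≠ 0 → 0 < inner ℝ (H w) w / speed (G x) +
      2 * Real.cos (2 * angle (f x) (G x) t) / Real.sin (2 * angle (f x) (G x) t)
        * inner ℝ (dir (G x)) w ^ 2 +
      (angle (f x) (G x) t)⁻¹ * (‖w‖ ^ 2 - inner ℝ (dir (G x)) w ^ 2) := by
  have hτ := ht.1.trans ht.2
  have ha := hf.one_add_pos hκ ht
  have ha1 := hf.one_add_eq hτ
  have hbase : ∀ h, f x + inner ℝ (G x) h - κ / (2 * τ) * ‖h‖ ^ 2 ≤ f (x + h) := fun h => by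
    rw [hG]; exact hf.add_ge hτ hκ h
  by_cases hp : G x = 0
  · have hangle : angle (f x) (G x) t = t / (1 + 2 * t * f x) := by rw [angle, if_pos hp]
    have hpos : 0 < angle (f x) (G x) t := by rw [hangle]; exact div_pos ht.1 ha
    refine ⟨hpos, fun w hw => ?_⟩
    have hsp : speed (G x) = 1 := if_pos hp
    have hw' : 0 < ‖w‖ ^ 2 := by have := norm_pos_iff.2 hw; positivity
    rw [hsp, hp, dir_zero, inner_zero_left, ← hp, hangle, inv_div, div_one, zero_pow two_ne_zero,
      mul_zero, add_zero, sub_zero]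
    -- If the product vanishes, the touching value at x is the least value of the profile, so f has
    -- a minimum at x and H ≥ 0. Otherwise the vanishing gradient forces x = y, where the profile
    -- has Hessian -κ/τ.
    by_cases hk : κ * cosSq (x - y) = 0
    · have h0 : (0 : ℝ) ≤ inner ℝ (H w) w := by
        refine quadForm_le_of_lower_taylor hS hx hC hb hH (Q := fun _ => 0) (C' := 0)
          continuous_const (fun _ _ => by simp) (Eventually.of_forall fun h => ?_) w
        have h1 := hf.1 (x + h)
        have h2 : 0 ≤ 1 / (2 * τ) * (κ * cosSq (x + h - y)) := by
          have := cosSq_nonneg (x + h - y); positivity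
        have h3 := hf.2
        rw [hk] at h3
        rw [hp, inner_zero_left]
        linarith
      have : 0 < (1 + 2 * t * f x) / t * ‖w‖ ^ 2 := mul_pos (div_pos ha ht.1) hw'
      linarith
    · have hκ0 : 0 < κ := lt_of_le_of_ne hκ fun h => hk (by rw [← h, zero_mul])
      have hc0 : cosSq (x - y) ≠ 0 := right_ne_zero_of_mul hk
      have hlt : ‖x - y‖ < Real.pi / 2 := by
        by_contra hge
        exact hc0 (by rw [cosSq, cosTrunc_of_ge (not_lt.1 hge), zero_pow two_ne_zero])
      have hxy : x - y = 0 := by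
        by_contra hne
        have hr := norm_pos_iff.2 hne
        have hs := Real.sin_pos_of_pos_of_lt_pi (x := 2 * ‖x - y‖) (by linarith) (by linarith)
        rw [hG, cosSqGrad, min_eq_left hlt.le, smul_smul] at hp
        rcases smul_eq_zero.1 hp with h | h
        · have : κ / (2 * τ) * (Real.sin (2 * ‖x - y‖) / ‖x - y‖) > 0 := by positivity
          linarith
        · exact hne h
      have hcs : cosSq (x - y) = 1 := by
        rw [hxy, cosSq, norm_zero, cosTrunc_of_le (by positivity), Real.cos_zero, one_pow]
      rw [hcs, mul_one] at ha1
      have h0 : -(κ / τ) * ‖w‖ ^ 2 ≤ inner ℝ (H w) w := by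
        refine quadForm_le_of_lower_taylor hS hx hC hb hH (Q := fun w => -(κ / τ) * ‖w‖ ^ 2)
          (C' := 0) (by fun_prop) (fun r w => ?_) (Eventually.of_forall fun h => ?_) w
        · rw [norm_smul, mul_pow, Real.norm_eq_abs, sq_abs]; ring
        · have := hbase h
          have e : κ / (2 * τ) = κ / τ / 2 := by field_simp
          rw [e] at this
          linarith
      have h1 : κ / τ < (1 + 2 * t * f x) / t := by
        rw [← ha1, div_lt_div_iff₀ hτ ht.1]
        nlinarith [ht.2]
      nlinarith
  · have hpn : 0 < ‖G x‖ := norm_pos_iff.2 hp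
    have hangle : angle (f x) (G x) t = Real.arctan (t * ‖G x‖ / (1 + 2 * t * f x)) := by
      rw [angle, if_neg hp]
    set β := angle (f x) (G x) t with hβ
    have hβ0 : 0 < β := by
      rw [hangle, Real.arctan_pos]
      exact div_pos (mul_pos ht.1 hpn) ha
    have hβ2 : β < Real.pi / 2 := by rw [hangle]; exact Real.arctan_lt_pi_div_two _
    refine ⟨hβ0, fun w hw => ?_⟩
    have hκ0 : 0 < κ := lt_of_le_of_ne hκ fun h => hp (by rw [hG, ← h]; simp)
    have hlt : ‖x - y‖ < Real.pi / 2 := by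
      by_contra hge
      refine hp ?_
      rw [hG, cosSqGrad, min_eq_right (not_lt.1 hge), show 2 * (Real.pi / 2) = Real.pi by ring,
        Real.sin_pi]
      simp
    have hne : x - y ≠ 0 := fun h => hp (by rw [hG, cosSqGrad, h]; simp)
    set v := x - y with hv
    have hr : 0 < ‖v‖ := norm_pos_iff.2 hne
    have hs : 0 < Real.sin (2 * ‖v‖) :=
      Real.sin_pos_of_pos_of_lt_pi (by linarith) (by linarith)
    have hcos : 0 < Real.cos ‖v‖ :=
      Real.cos_pos_of_mem_Ioo ⟨by linarith [Real.pi_pos], hlt⟩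
    rw [cosSqGrad, min_eq_left hlt.le, smul_smul] at hG
    have hnorm : ‖G x‖ = κ / (2 * τ) * Real.sin (2 * ‖v‖) := by
      rw [hG, norm_smul, norm_mul, norm_neg, Real.norm_of_nonneg (by positivity),
        Real.norm_of_nonneg (by positivity)]
      field_simp
    have ha1' : 1 + 2 * τ * f x = κ * Real.cos ‖v‖ ^ 2 := by
      rw [ha1, cosSq, cosTrunc_of_le hlt.le]
    -- The angle at the touching time τ is exactly |x - y|; the angle is increasing, so β < |x - y|
    -- at the earlier time t.
    have htan : τ * ‖G x‖ / (1 + 2 * τ * f x) = Real.tan ‖v‖ := by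
      rw [hnorm, ha1', Real.sin_two_mul, Real.tan_eq_sin_div_cos]
      field_simp
    have hβr : β < ‖v‖ := by
      rw [hangle, ← Real.arctan_tan (by linarith [Real.pi_pos]) hlt, Real.arctan_lt_arctan_iff,
        ← htan, div_lt_div_iff₀ ha (by rw [ha1']; positivity)]
      nlinarith [mul_pos hpn (sub_pos.2 ht.2)]
    obtain ⟨C', hC'⟩ := cosSq_add_ge_cubic hne hlt
    have hlow : κ / (2 * τ) * cosSqHess v w ≤ inner ℝ (H w) w := by
      refine quadForm_le_of_lower_taylor hS hx hC hb hH
        (Q := fun w => κ / (2 * τ) * cosSqHess v w) (C' := κ / (2 * τ) * C')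
        ?_ (fun r w => ?_) ?_ w
      · unfold cosSqHess; fun_prop
      · simp only [cosSqHess]
        rw [norm_smul, mul_pow, Real.norm_eq_abs, sq_abs, real_inner_smul_right]; ring
      · filter_upwards [hC'] with h hh
        have h1 := hf.1 (x + h)
        rw [show x + h - y = v + h by rw [hv]; abel] at h1
        rw [cosSqGrad, min_eq_left hlt.le, real_inner_smul_left] at hh
        rw [hf.2, ← hv, hG, real_inner_smul_left]
        have h3 := mul_le_mul_of_nonneg_left hh (by positivity : 0 ≤ κ / (2 * τ))
        have e : ∀ b : ℝ, 1 / (2 * τ) * (1 - κ * b) = 1 / (2 * τ) - κ / (2 * τ) * b :=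
          fun b => by ring
        rw [e] at h1 ⊢
        linarith
    have hdir : inner ℝ (dir (G x)) w ^ 2 = (inner ℝ v w / ‖v‖) ^ 2 := by
      rw [dir, speed_of_ne hp, real_inner_smul_left, hnorm, hG, real_inner_smul_left]
      field_simp
    -- Divided by |p|, the Hessian of the profile is -2 cot(2|v|) along the direction of p and
    -- -1/|v| across it.
    have hlow' : -(‖v‖)⁻¹ * ‖w‖ ^ 2 +
        ((‖v‖)⁻¹ - 2 * Real.cos (2 * ‖v‖) / Real.sin (2 * ‖v‖)) * inner ℝ (dir (G x)) w ^ 2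
        ≤ inner ℝ (H w) w / speed (G x) := by
      rw [speed_of_ne hp, le_div_iff₀ hpn]
      refine le_trans (le_of_eq ?_) hlow
      rw [hdir, hnorm, cosSqHess]
      generalize Real.sin (2 * ‖v‖) = σ at hs
      field_simp
    have h1 : (‖v‖)⁻¹ < β⁻¹ := inv_strictAnti₀ hβ0 hβr
    have h2 := cos_div_sin_lt (A := 2 * β) (B := 2 * ‖v‖) (by linarith) (by linarith)
      (by linarith)
    have h3 := inner_dir_sq_le (G x) w
    have hw' : 0 < ‖w‖ ^ 2 := by have := norm_pos_iff.2 hw; positivity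
    set i2 := inner ℝ (dir (G x)) w ^ 2
    have hi2 : 0 ≤ i2 := sq_nonneg _
    rw [mul_div_assoc] at hlow' ⊢
    -- Both gaps are strictly positive, by monotonicity of 1/β and of the cotangent; for w ≠ 0 at
    -- least one of them carries a positive weight.
    have hsum : 0 < (β⁻¹ - ‖v‖⁻¹) * (‖w‖ ^ 2 - i2) + 2 * (Real.cos (2 * β) / Real.sin (2 * β)
        - Real.cos (2 * ‖v‖) / Real.sin (2 * ‖v‖)) * i2 := by
      rcases hi2.lt_or_eq with h | h
      · have e1 := mul_nonneg (sub_pos.2 h1).le (sub_nonneg.2 h3)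
        have e2 := mul_pos (sub_pos.2 h2) h
        linarith
      · rw [← h]
        have e1 := mul_pos (sub_pos.2 h1) hw'
        linarith
    linarith

/-! ### Concavity of the determinant of a matrix Jacobi field -/

section Jacobi

variable {ι : Type*} [Fintype ι] [DecidableEq ι]

set_option linter.unusedSectionVars false

/-- The matrix acting as `a` on the range of the projection `P` and as `b` on its kernel. -/
noncomputable def blockScalar (P : Matrix ι ι ℝ) (a b : ℝ) : Matrix ι ι ℝ := a • P + b • (1 - P)

lemma blockScalar_mul {P : Matrix ι ι ℝ} (hP : P * P = P) (a b a' b' : ℝ) :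
    blockScalar P a b * blockScalar P a' b' = blockScalar P (a * a') (b * b') := by
  have h1 : P * (1 - P) = 0 := by rw [mul_sub, mul_one, hP, sub_self]
  have h2 : (1 - P) * P = 0 := by rw [sub_mul, one_mul, hP, sub_self]
  have h3 : (1 - P) * (1 - P) = 1 - P := by rw [mul_sub, mul_one, h2, sub_zero]
  simp only [blockScalar, add_mul, mul_add, smul_mul_smul_comm, hP, h1, h2, h3, smul_zero,
    add_zero, zero_add]

lemma blockScalar_add (P : Matrix ι ι ℝ) (a b a' b' : ℝ) :
    blockScalar P a b + blockScalar P a' b' = blockScalar P (a + a') (b + b') := by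
  simp only [blockScalar, add_smul]; abel

lemma blockScalar_neg (P : Matrix ι ι ℝ) (a b : ℝ) :
    -blockScalar P a b = blockScalar P (-a) (-b) := by
  simp only [blockScalar, neg_smul]; abel

lemma blockScalar_one (P : Matrix ι ι ℝ) : blockScalar P 1 1 = 1 := by
  simp [blockScalar]

lemma blockScalar_transpose {P : Matrix ι ι ℝ} (hP : P.transpose = P) (a b : ℝ) :
    (blockScalar P a b).transpose = blockScalar P a b := by
  simp [blockScalar, Matrix.transpose_add, Matrix.transpose_smul, Matrix.transpose_sub, hP]

lemma trace_blockScalar_mul (P U : Matrix ι ι ℝ) (a b : ℝ) :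
    (blockScalar P a b * U).trace = b * U.trace + (a - b) * (P * U).trace := by
  simp only [blockScalar, add_mul, sub_mul, Matrix.smul_mul, one_mul, Matrix.trace_add,
    Matrix.trace_smul, Matrix.trace_sub, smul_eq_mul]
  ring

/-! ### Arithmetic–geometric mean inequality for determinants -/

lemma det_rpow_le_trace_div [Nonempty ι] {X : Matrix ι ι ℝ} (hX : X.PosSemidef) :
    X.det ^ (1 / (Fintype.card ι : ℝ)) ≤ X.trace / Fintype.card ι := by
  have hc : (0 : ℝ) < Fintype.card ι := by exact_mod_cast Fintype.card_pos
  rw [hX.isHermitian.det_eq_prod_eigenvalues, hX.isHermitian.trace_eq_sum_eigenvalues]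
  have h := Real.geom_mean_le_arith_mean_weighted Finset.univ
    (fun _ : ι => 1 / (Fintype.card ι : ℝ)) hX.isHermitian.eigenvalues
    (fun _ _ => by positivity) (by simp [hc.ne'])
    (fun i _ => hX.eigenvalues_nonneg i)
  rw [← Finset.mul_sum, Real.finsetProd_rpow _ _ (fun i _ => hX.eigenvalues_nonneg i)] at h
  refine (le_of_eq ?_).trans (h.trans (le_of_eq ?_))
  · simp
  · simp; ring

lemma posSemidef_one_add {X : Matrix ι ι ℝ} (hX : X.transpose = X)
    (h : ∑ i, ∑ j, |X i j| ≤ 1) : (1 + X).PosSemidef := by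
  refine Matrix.PosSemidef.of_dotProduct_mulVec_nonneg ?_ fun v => ?_
  · rw [Matrix.IsHermitian, Matrix.conjTranspose_eq_transpose_of_trivial, Matrix.transpose_add,
      Matrix.transpose_one, hX]
  · rw [star_trivial, Matrix.add_mulVec, Matrix.one_mulVec, dotProduct_add]
    have h1 : -(∑ i, ∑ j, |X i j|) * (v ⬝ᵥ v) ≤ v ⬝ᵥ X.mulVec v := by
      have e : v ⬝ᵥ X.mulVec v = ∑ i, ∑ j, v i * (X i j * v j) := by
        simp only [dotProduct, Matrix.mulVec, Finset.mul_sum]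
      rw [e, neg_mul, Finset.sum_mul, ← Finset.sum_neg_distrib]
      refine Finset.sum_le_sum fun i _ => ?_
      rw [Finset.sum_mul, ← Finset.sum_neg_distrib]
      refine Finset.sum_le_sum fun j _ => ?_
      have hv : ∀ i, v i ^ 2 ≤ v ⬝ᵥ v := fun i => by
        rw [dotProduct, sq]
        exact Finset.single_le_sum (f := fun i => v i * v i) (fun i _ => mul_self_nonneg _)
          (Finset.mem_univ i)
      have h2 : |v i * v j| ≤ v ⬝ᵥ v := by
        rw [abs_le]
        constructor <;> nlinarith [hv i, hv j, sq_nonneg (v i - v j), sq_nonneg (v i + v j)]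
      rw [show v i * (X i j * v j) = X i j * (v i * v j) by ring]
      refine (neg_le_neg ?_).trans (neg_abs_le _)
      rw [abs_mul]
      gcongr
    have h0 : 0 ≤ v ⬝ᵥ v := by
      rw [dotProduct]; exact Finset.sum_nonneg fun i _ => mul_self_nonneg _
    nlinarith

/-- The product DU of a block scalar D with U need not be symmetric. With S the square root of D,
det(1 + S²U) = det(1 + SUS), and 1 + SUS is symmetric and, for small ε, positive semidefinite. -/
lemma eventually_det_rpow_le [Nonempty ι] {P U : Matrix ι ι ℝ} (hPt : P.transpose = P)
    (hP : P * P = P) (hU : U.transpose = U) :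
    ∃ δ > 0, ∀ ε ∈ Ioo 0 δ,
      (1 + blockScalar P (Real.tan (2 * ε) / 2) ε * U).det ^ (1 / (Fintype.card ι : ℝ))
        ≤ 1 + (blockScalar P (Real.tan (2 * ε) / 2) ε * U).trace / Fintype.card ι := by
  have hc : (0 : ℝ) < Fintype.card ι := by exact_mod_cast Fintype.card_pos
  set Φ : ℝ × ℝ → ℝ := fun q =>
    ∑ i, ∑ j, |(blockScalar P q.1 q.2 * U * blockScalar P q.1 q.2) i j| with hΦ
  have hΦc : Continuous Φ := by
    have hD : Continuous fun q : ℝ × ℝ => blockScalar P q.1 q.2 := by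
      unfold blockScalar; fun_prop
    have hM : Continuous fun q : ℝ × ℝ => blockScalar P q.1 q.2 * U * blockScalar P q.1 q.2 :=
      (hD.matrix_mul continuous_const).matrix_mul hD
    exact continuous_finsetSum _ fun i _ => continuous_finsetSum _ fun j _ =>
      (hM.matrix_elem i j).abs
  have hΦ0 : Φ (0, 0) = 0 := by simp [hΦ, blockScalar]
  have hlim : Tendsto (fun ε : ℝ => Φ (√(Real.tan (2 * ε) / 2), √ε)) (𝓝 0) (𝓝 0) := by
    have ht : ContinuousAt (fun ε : ℝ => Real.tan (2 * ε)) 0 := by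
      have : ContinuousAt Real.tan (2 * 0) := Real.continuousAt_tan.2 (by simp)
      exact ContinuousAt.comp (f := fun ε : ℝ => 2 * ε) this (by fun_prop)
    have h1 : ContinuousAt (fun ε : ℝ => (√(Real.tan (2 * ε) / 2), √ε)) 0 :=
      ((ht.div_const 2).sqrt).prodMk (Real.continuous_sqrt.continuousAt)
    have h2 : ContinuousAt (fun ε : ℝ => Φ (√(Real.tan (2 * ε) / 2), √ε)) 0 :=
      ContinuousAt.comp (g := Φ) hΦc.continuousAt h1
    have h3 := h2.tendsto
    simpa [hΦ0] using h3
  obtain ⟨δ, hδ, hδ'⟩ := Metric.eventually_nhds_iff.1 (hlim.eventually (gt_mem_nhds one_pos))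
  -- The bound π/4 keeps tan(2ε) nonnegative, so that the square root of D exists.
  refine ⟨min δ (Real.pi / 4), lt_min hδ (by positivity), fun ε hε => ?_⟩
  have hε1 : ε < δ := hε.2.trans_le (min_le_left _ _)
  have hε2 : ε < Real.pi / 4 := hε.2.trans_le (min_le_right _ _)
  have htan : 0 ≤ Real.tan (2 * ε) / 2 :=
    div_nonneg (Real.tan_nonneg_of_nonneg_of_le_pi_div_two (by linarith [hε.1]) (by linarith))
      zero_le_two
  have hsmall := hδ' (y := ε) (by rw [Real.dist_eq, sub_zero, abs_of_pos hε.1]; exact hε1)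
  set S := blockScalar P (√(Real.tan (2 * ε) / 2)) (√ε) with hS
  have hSS : S * S = blockScalar P (Real.tan (2 * ε) / 2) ε := by
    rw [hS, blockScalar_mul hP, Real.mul_self_sqrt htan, Real.mul_self_sqrt hε.1.le]
  have hpsd : (1 + S * U * S).PosSemidef := by
    refine posSemidef_one_add ?_ hsmall.le
    rw [Matrix.transpose_mul, Matrix.transpose_mul, hU, hS, blockScalar_transpose hPt, mul_assoc]
  have h := det_rpow_le_trace_div hpsd
  rw [← hSS, mul_assoc, Matrix.det_one_add_mul_comm, Matrix.trace_mul_comm S (S * U)]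
  refine h.trans (le_of_eq ?_)
  rw [Matrix.trace_add, Matrix.trace_one, add_div, div_self hc.ne']

/-- The matrix Jacobi field with initial value `1` and initial derivative `K`, for the curvature
`4 P`. -/
noncomputable def jacobiField (P K : Matrix ι ι ℝ) (β : ℝ) : Matrix ι ι ℝ :=
  blockScalar P (Real.cos (2 * β)) 1 + blockScalar P (Real.sin (2 * β) / 2) β * K

/-- The derivative of `jacobiField`. -/
noncomputable def jacobiFieldDeriv (P K : Matrix ι ι ℝ) (β : ℝ) : Matrix ι ι ℝ :=
  blockScalar P (-(2 * Real.sin (2 * β))) 0 + blockScalar P (Real.cos (2 * β)) 1 * K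

/-- The Wronskian of B'' = -4PB is constant and equals K - Kᵀ = 0 at β = 0. The verification is
algebraic: block scalars commute, and D₁² - D₃D₂ = 1 is cos² + sin² = 1. -/
lemma jacobiField_wronskian {P K : Matrix ι ι ℝ} (hPt : P.transpose = P) (hP : P * P = P)
    (hK : K.transpose = K) (β : ℝ) :
    (jacobiField P K β).transpose * jacobiFieldDeriv P K β =
      (jacobiFieldDeriv P K β).transpose * jacobiField P K β := by
  simp only [jacobiField, jacobiFieldDeriv, Matrix.transpose_add, Matrix.transpose_mul,
    blockScalar_transpose hPt, hK]
  set D₁ := blockScalar P (Real.cos (2 * β)) 1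
  set D₂ := blockScalar P (Real.sin (2 * β) / 2) β
  set D₃ := blockScalar P (-(2 * Real.sin (2 * β))) 0
  have c12 : D₁ * D₂ = D₂ * D₁ := by simp only [D₁, D₂, blockScalar_mul hP, mul_comm]
  have c13 : D₁ * D₃ = D₃ * D₁ := by simp only [D₁, D₃, blockScalar_mul hP, mul_comm]
  have c23 : D₂ * D₃ = D₃ * D₂ := by simp only [D₂, D₃, blockScalar_mul hP, mul_comm]
  have key : D₁ * D₁ = 1 + D₃ * D₂ := by
    rw [← blockScalar_one P]
    simp only [D₁, D₂, D₃, blockScalar_mul hP, blockScalar_add]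
    congr 1
    · have := Real.sin_sq_add_cos_sq (2 * β); nlinarith
    · ring
  have e1 : (D₁ + K * D₂) * (D₃ + D₁ * K) = D₁ * D₃ + D₁ * D₁ * K + K * (D₂ * D₃)
      + K * (D₂ * D₁) * K := by noncomm_ring
  have e2 : (D₃ + K * D₁) * (D₁ + D₂ * K) = D₃ * D₁ + D₃ * D₂ * K + K * (D₁ * D₁)
      + K * (D₁ * D₂) * K := by noncomm_ring
  rw [e1, e2, key, c13, c23, c12]
  noncomm_ring

lemma jacobiField_add {P K : Matrix ι ι ℝ} (hP : P * P = P) (β ε : ℝ) :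
    jacobiField P K (β + ε) =
      blockScalar P (Real.cos (2 * ε)) 1 * jacobiField P K β +
        blockScalar P (Real.sin (2 * ε) / 2) ε * jacobiFieldDeriv P K β := by
  simp only [jacobiField, jacobiFieldDeriv, mul_add, ← mul_assoc, blockScalar_mul hP]
  have e : ∀ A B C D : Matrix ι ι ℝ, A + B * K + (C + D * K) = (A + C) + (B + D) * K := by
    intro A B C D; noncomm_ring
  rw [e, blockScalar_add, blockScalar_add, Real.cos_add, Real.sin_add]
  congr 3 <;> ring

/-- This restarts the field at β, reducing all later computations to ε = 0. The matrix U = B'B⁻¹ is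
symmetric because the Wronskian vanishes. -/
lemma exists_symm_jacobiField_add {P K : Matrix ι ι ℝ} (hPt : P.transpose = P) (hP : P * P = P)
    (hK : K.transpose = K) {β : ℝ} (hβ : 0 < (jacobiField P K β).det) :
    ∃ U : Matrix ι ι ℝ, U.transpose = U ∧ ∀ ε, jacobiField P K (β + ε) =
      jacobiField P U ε * jacobiField P K β := by
  set B := jacobiField P K β with hB
  set B' := jacobiFieldDeriv P K β with hB'
  have hunit : IsUnit B.det := hβ.ne'.isUnit
  have hunitT : IsUnit B.transpose.det := by rwa [Matrix.det_transpose]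
  refine ⟨B' * B⁻¹, ?_, fun ε => ?_⟩
  · have hW := jacobiField_wronskian hPt hP hK β
    have h1 : B.transpose⁻¹ * (B.transpose * B') * B⁻¹
        = B.transpose⁻¹ * (B'.transpose * B) * B⁻¹ := by rw [hB, hB', hW]
    rw [← mul_assoc, Matrix.nonsing_inv_mul _ hunitT, one_mul, ← mul_assoc, mul_assoc _ B,
      Matrix.mul_nonsing_inv _ hunit, mul_one] at h1
    rw [Matrix.transpose_mul, Matrix.transpose_nonsing_inv, h1]
  · rw [jacobiField_add hP, ← hB, ← hB']
    rw [show jacobiField P (B' * B⁻¹) ε = blockScalar P (Real.cos (2 * ε)) 1 +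
      blockScalar P (Real.sin (2 * ε) / 2) ε * (B' * B⁻¹) from rfl, add_mul, mul_assoc, mul_assoc, Matrix.nonsing_inv_mul _ hunit, mul_one]

lemma blockScalar_tan {P U : Matrix ι ι ℝ} (hP : P * P = P) {ε : ℝ} (hε : Real.cos (2 * ε) ≠ 0) :
    jacobiField P U ε = blockScalar P (Real.cos (2 * ε)) 1 *
      (1 + blockScalar P (Real.tan (2 * ε) / 2) ε * U) := by
  rw [mul_add, mul_one, ← mul_assoc, blockScalar_mul hP, jacobiField, Real.tan_eq_sin_div_cos]
  congr 3
  · field_simp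
  · ring

/-- The second-order upper barrier for the determinant of a Jacobi field. -/
noncomputable def detBarrier (k n t u ε : ℝ) : ℝ :=
  (1 + (Real.cos (2 * ε) - 1) * k) ^ (1 / n) *
    (1 + (ε * t + (Real.tan (2 * ε) / 2 - ε) * u) / n)

lemma det_jacobiField_rpow_le [Nonempty ι] {P U : Matrix ι ι ℝ} (hPt : P.transpose = P)
    (hP : P * P = P) {k : ℝ} (hk : ∀ a, (blockScalar P a 1).det = 1 + (a - 1) * k)
    (hU : U.transpose = U) :
    ∀ᶠ ε in 𝓝 (0 : ℝ), 0 < (jacobiField P U ε).det ∧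
      (jacobiField P U ε).det ^ (1 / (Fintype.card ι : ℝ)) ≤
        detBarrier k (Fintype.card ι) U.trace (P * U).trace ε ∧
      (Fintype.card ι = 1 → (jacobiField P U ε).det ^ (1 / (Fintype.card ι : ℝ)) =
        detBarrier k (Fintype.card ι) U.trace (P * U).trace ε) := by
  have hcont : Continuous fun ε => (jacobiField P U ε).det := by
    refine Continuous.matrix_det ?_
    unfold jacobiField blockScalar
    have h1 : Continuous fun β : ℝ => (Real.sin (2 * β) / 2) • P + β • (1 - P) := by fun_prop
    have h2 : Continuous fun β : ℝ => Real.cos (2 * β) • P + (1 : ℝ) • (1 - P) := by fun_prop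
    exact h2.add (h1.matrix_mul continuous_const)
  have h0 : (jacobiField P U 0).det = 1 := by
    have : jacobiField P U 0 = 1 := by simp [jacobiField, blockScalar]
    rw [this, Matrix.det_one]
  have hdpos : ∀ᶠ ε in 𝓝 (0 : ℝ), 0 < (jacobiField P U ε).det :=
    hcont.continuousAt.eventually (lt_mem_nhds (by simp only [h0]; exact one_pos))
  have hcos : ∀ᶠ ε in 𝓝 (0 : ℝ), 0 < Real.cos (2 * ε) :=
    (Real.continuous_cos.comp (continuous_const_mul 2)).continuousAt.eventually
      (lt_mem_nhds (by simp))
  have hkpos : ∀ᶠ ε in 𝓝 (0 : ℝ), 0 < 1 + (Real.cos (2 * ε) - 1) * k := by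
    have : Continuous fun ε : ℝ => 1 + (Real.cos (2 * ε) - 1) * k := by fun_prop
    exact this.continuousAt.eventually (lt_mem_nhds (by simp))
  obtain ⟨δ₁, hδ₁, h₁⟩ := eventually_det_rpow_le hPt hP hU
  obtain ⟨δ₂, hδ₂, h₂⟩ := eventually_det_rpow_le (U := -U) hPt hP
    (by rw [Matrix.transpose_neg, hU])
  have hlt : ∀ᶠ ε in 𝓝 (0 : ℝ), ε < δ₁ := gt_mem_nhds hδ₁
  have hgt : ∀ᶠ ε in 𝓝 (0 : ℝ), -δ₂ < ε := lt_mem_nhds (by linarith)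
  filter_upwards [hdpos, hcos, hkpos, hlt, hgt] with ε e1 e2 e3 e4 e5
  have hdet := congrArg Matrix.det (blockScalar_tan (U := U) hP e2.ne')
  rw [Matrix.det_mul, hk] at hdet
  have hpos2 : 0 < (1 + blockScalar P (Real.tan (2 * ε) / 2) ε * U).det := by
    rw [hdet] at e1
    exact (pos_iff_pos_of_mul_pos e1).1 e3
  have htr : (blockScalar P (Real.tan (2 * ε) / 2) ε * U).trace =
      ε * U.trace + (Real.tan (2 * ε) / 2 - ε) * (P * U).trace := trace_blockScalar_mul _ _ _ _
  refine ⟨e1, ?_, fun h1 => ?_⟩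
  · rw [hdet, Real.mul_rpow e3.le hpos2.le, detBarrier, ← htr]
    refine mul_le_mul_of_nonneg_left ?_ (Real.rpow_nonneg e3.le _)
    rcases lt_trichotomy ε 0 with h | h | h
    -- For negative ε the inequality is applied to -ε and -U, which leaves the product of block
    -- scalar and matrix unchanged.
    · have := h₂ (-ε) ⟨by linarith, by linarith⟩
      rw [show 2 * -ε = -(2 * ε) by ring, Real.tan_neg, neg_div, ← blockScalar_neg,
        neg_mul_neg] at this
      exact this
    · subst h
      simp [blockScalar]
    · exact h₁ ε ⟨h, e4⟩
  · obtain ⟨i, hi⟩ := Fintype.card_eq_one_iff.1 h1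
    let inst : Unique ι := ⟨⟨i⟩, hi⟩
    rw [hdet, detBarrier, h1, ← htr, Nat.cast_one, div_one, div_one, Real.rpow_one, Real.rpow_one]
    congr 1
    rw [Matrix.det_unique, Matrix.trace, Fintype.sum_unique]
    simp

/-! ### Comparison of pointwise second derivatives -/

/-- `f` has second derivative `c` at `x`. -/
def HasSecondDerivAt (f : ℝ → ℝ) (c x : ℝ) : Prop :=
  ∃ f' : ℝ → ℝ, (∀ᶠ y in 𝓝 x, HasDerivAt f (f' y) y) ∧ HasDerivAt f' c x

lemma HasSecondDerivAt.deriv_deriv {f : ℝ → ℝ} {c x : ℝ} (h : HasSecondDerivAt f c x) :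
    deriv (deriv f) x = c := by
  obtain ⟨f', h1, h2⟩ := h
  have : deriv f =ᶠ[𝓝 x] f' := h1.mono fun y hy => hy.deriv
  rw [this.deriv_eq, h2.deriv]

lemma HasSecondDerivAt.sub {f g : ℝ → ℝ} {a b x : ℝ} (hf : HasSecondDerivAt f a x)
    (hg : HasSecondDerivAt g b x) : HasSecondDerivAt (fun y => f y - g y) (a - b) x := by
  obtain ⟨f', h1, h2⟩ := hf
  obtain ⟨g', h3, h4⟩ := hg
  exact ⟨fun y => f' y - g' y, by filter_upwards [h1, h3] with y h5 h6 using h5.sub h6, h2.sub h4⟩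

/-- The difference g - f has a local minimum at x. A negative second derivative would make x a local
maximum as well, so g - f would be locally constant, a contradiction. -/
lemma HasSecondDerivAt.mono {f g : ℝ → ℝ} {a b x : ℝ} (hf : HasSecondDerivAt f a x)
    (hg : HasSecondDerivAt g b x) (hle : ∀ᶠ y in 𝓝 x, f y ≤ g y) (heq : f x = g x) : a ≤ b := by
  have h := hg.sub hf
  set F : ℝ → ℝ := fun y => g y - f y with hF
  have hFx : F x = 0 := by rw [hF]; simp only; rw [heq, sub_self]
  have hmin : IsLocalMin F x := by
    filter_upwards [hle] with y hy
    rw [hFx]; exact sub_nonneg.2 hy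
  by_contra hlt
  have hd2 : deriv (deriv F) x < 0 := by rw [h.deriv_deriv]; linarith
  obtain ⟨F', h1, h2⟩ := id h
  have hmax := isLocalMax_of_deriv_deriv_neg hd2 hmin.deriv_eq_zero h1.self_of_nhds.continuousAt
  have hconst : F =ᶠ[𝓝 x] fun _ => F x := by
    filter_upwards [hmin, hmax] with y h3 h4 using le_antisymm h4 h3
  have hd1 : deriv F =ᶠ[𝓝 x] fun _ => 0 := by
    simpa using hconst.deriv
  rw [hd1.deriv_eq] at hd2
  simp at hd2

lemma HasSecondDerivAt.congr {f g : ℝ → ℝ} {a x : ℝ} (hf : HasSecondDerivAt f a x)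
    (h : f =ᶠ[𝓝 x] g) : HasSecondDerivAt g a x := by
  obtain ⟨f', h1, h2⟩ := hf
  refine ⟨f', ?_, h2⟩
  filter_upwards [h1, h.eventuallyEq_nhds] with y h3 h4 using h3.congr_of_eventuallyEq h4.symm

lemma HasSecondDerivAt.unique {f : ℝ → ℝ} {a b x : ℝ} (hf : HasSecondDerivAt f a x)
    (hg : HasSecondDerivAt f b x) : a = b := hf.deriv_deriv.symm.trans hg.deriv_deriv

lemma HasSecondDerivAt.const_mul {f : ℝ → ℝ} {a x : ℝ} (hf : HasSecondDerivAt f a x) (c : ℝ) :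
    HasSecondDerivAt (fun y => c * f y) (c * a) x := by
  obtain ⟨f', h1, h2⟩ := hf
  exact ⟨fun y => c * f' y, h1.mono fun y hy => hy.const_mul c, h2.const_mul c⟩

lemma HasSecondDerivAt.comp_sub {f : ℝ → ℝ} {a x : ℝ} (hf : HasSecondDerivAt f a 0) :
    HasSecondDerivAt (fun y => f (y - x)) a x := by
  obtain ⟨f', h1, h2⟩ := hf
  have hlim : Tendsto (fun y => y - x) (𝓝 x) (𝓝 0) := tendsto_sub_nhds_zero_iff.2 tendsto_id
  refine ⟨fun y => f' (y - x), (hlim.eventually h1).mono fun y hy => hy.comp_sub_const y x, ?_⟩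
  rw [← sub_self x] at h2
  exact h2.comp_sub_const x x

lemma hasSecondDerivAt_of_contDiffAt {f : ℝ → ℝ} {x : ℝ} (h : ContDiffAt ℝ 2 f x) :
    HasSecondDerivAt f (deriv (deriv f) x) x := by
  have h1 : ∀ᶠ y in 𝓝 x, ContDiffAt ℝ 2 f y := h.eventually (by simp)
  refine ⟨deriv f, h1.mono fun y hy => (hy.differentiableAt (by norm_num)).hasDerivAt, ?_⟩
  have h2 : ContDiffAt ℝ 1 (deriv f) x := h.derivWithin (by norm_num)
  exact (h2.differentiableAt (by norm_num)).hasDerivAt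

/-- The parameters t and u drop out: tan(2ε)/2 - ε is of third order, so the second factor is affine
up to O(ε³), and the first factor has zero derivative at 0, so no cross term survives. -/
lemma hasSecondDerivAt_detBarrier {k n : ℝ} (t u : ℝ) :
    HasSecondDerivAt (detBarrier k n t u) (-(4 * k / n)) 0 := by
  have hcos : ∀ᶠ ε in 𝓝 (0 : ℝ), 0 < Real.cos (2 * ε) :=
    (Real.continuous_cos.comp (continuous_const_mul 2)).continuousAt.eventually
      (lt_mem_nhds (by simp))
  have hkpos : ∀ᶠ ε in 𝓝 (0 : ℝ), 0 < 1 + (Real.cos (2 * ε) - 1) * k := by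
    have : Continuous fun ε : ℝ => 1 + (Real.cos (2 * ε) - 1) * k := by fun_prop
    exact this.continuousAt.eventually (lt_mem_nhds (by simp))
  have h2 : ∀ ε : ℝ, HasDerivAt (fun ε : ℝ => 2 * ε) 2 ε := fun ε => by
    simpa using (hasDerivAt_id ε).const_mul 2
  have hc : ∀ ε : ℝ, HasDerivAt (fun ε => 1 + (Real.cos (2 * ε) - 1) * k)
      (-Real.sin (2 * ε) * 2 * k) ε := fun ε =>
    ((((h2 ε).cos).sub_const 1).mul_const k).const_add 1
  have hA : ∀ p : ℝ, ∀ᶠ ε in 𝓝 (0 : ℝ), HasDerivAt (fun ε => (1 + (Real.cos (2 * ε) - 1) * k) ^ p)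
      (-Real.sin (2 * ε) * 2 * k * p * (1 + (Real.cos (2 * ε) - 1) * k) ^ (p - 1)) ε := fun p => by
    filter_upwards [hkpos] with ε hε
    exact (hc ε).rpow_const (Or.inl hε.ne')
  have hT : ∀ᶠ ε in 𝓝 (0 : ℝ),
      HasDerivAt (fun ε => 1 + (ε * t + (Real.tan (2 * ε) / 2 - ε) * u) / n)
      ((t + ((Real.cos (2 * ε) ^ 2)⁻¹ - 1) * u) / n) ε := by
    filter_upwards [hcos] with ε hε
    have h3 := (Real.hasDerivAt_tan hε.ne').comp ε (h2 ε)
    have h4 := (((((hasDerivAt_id ε).mul_const t).add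
      (((h3.div_const 2).sub (hasDerivAt_id ε)).mul_const u)).div_const n).const_add 1)
    refine h4.congr_deriv ?_
    field_simp
  refine ⟨_, (hA (1 / n)).and hT |>.mono fun ε h => h.1.mul h.2, ?_⟩
  have hs : HasDerivAt (fun ε : ℝ => -Real.sin (2 * ε) * 2 * k * (1 / n)) (-(4 * k / n)) 0 := by
    refine ((((h2 0).sin.neg).mul_const 2).mul_const k |>.mul_const (1 / n)).congr_deriv ?_
    simp; ring
  have hT' : HasDerivAt (fun ε : ℝ => (t + ((Real.cos (2 * ε) ^ 2)⁻¹ - 1) * u) / n) 0 0 := by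
    have h3 : HasDerivAt (fun ε : ℝ => (Real.cos (2 * ε) ^ 2)⁻¹) 0 0 := by
      refine (((h2 0).cos.pow 2).inv (by simp)).congr_deriv ?_
      simp
    simpa using (((h3.sub_const 1).mul_const u).const_add t).div_const n
  have h5 := ((hs.mul (hA (1 / n - 1)).self_of_nhds).mul hT.self_of_nhds).add
    ((hA (1 / n)).self_of_nhds.mul hT')
  refine h5.congr_deriv ?_
  simp

lemma contDiff_det_jacobiField (P K : Matrix ι ι ℝ) :
    ContDiff ℝ 2 fun β => (jacobiField P K β).det := by
  have hentry : ∀ i j, ContDiff ℝ 2 fun β => jacobiField P K β i j := by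
    intro i j
    have e : (fun β => jacobiField P K β i j) = fun β => Real.cos (2 * β) * P i j +
        1 * (1 - P) i j + (Real.sin (2 * β) / 2 * (P * K) i j + β * ((1 - P) * K) i j) := by
      funext β
      simp only [jacobiField, blockScalar, add_mul, Matrix.smul_mul, Matrix.add_apply,
        Matrix.smul_apply, smul_eq_mul]
    rw [e]
    fun_prop
  simp only [Matrix.det_apply']
  exact ContDiff.sum fun σ _ => contDiff_const.mul (contDiff_prod fun i _ => hentry _ _)

/-- The `n`-th root of the determinant of a Jacobi field satisfies the concavity inequality. -/
lemma exists_hasSecondDerivAt_det_rpow [Nonempty ι] {P K : Matrix ι ι ℝ}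
    (hPt : P.transpose = P) (hP : P * P = P) {k : ℝ}
    (hk : ∀ a, (blockScalar P a 1).det = 1 + (a - 1) * k) (hK : K.transpose = K) {β : ℝ}
    (hβ : 0 < (jacobiField P K β).det) :
    ∃ c, HasSecondDerivAt (fun β => (jacobiField P K β).det ^ (1 / (Fintype.card ι : ℝ))) c β ∧
      c ≤ -(4 * k / Fintype.card ι) * (jacobiField P K β).det ^ (1 / (Fintype.card ι : ℝ)) ∧
      (Fintype.card ι = 1 → c =
        -(4 * k / Fintype.card ι) * (jacobiField P K β).det ^ (1 / (Fintype.card ι : ℝ))) := by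
  set n : ℝ := (Fintype.card ι : ℝ) with hn
  obtain ⟨U, hU, hadd⟩ := exists_symm_jacobiField_add hPt hP hK hβ
  have hsm : ContDiffAt ℝ 2 (fun β => (jacobiField P K β).det ^ (1 / n)) β :=
    (contDiff_det_jacobiField P K).contDiffAt.rpow_const_of_ne hβ.ne'
  have hs := hasSecondDerivAt_of_contDiffAt hsm
  set c := deriv (deriv fun β => (jacobiField P K β).det ^ (1 / n)) β
  set g := (jacobiField P K β).det ^ (1 / n) with hg
  -- The barrier, scaled by the value at β and centred there, lies above the root of the determinant
  -- near β and touches it at β.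
  have hbar : HasSecondDerivAt (fun y => g * detBarrier k n U.trace (P * U).trace (y - β))
      (g * -(4 * k / n)) β :=
    (hasSecondDerivAt_detBarrier U.trace (P * U).trace).comp_sub.const_mul g
  have hlim : Tendsto (fun y => y - β) (𝓝 β) (𝓝 0) := tendsto_sub_nhds_zero_iff.2 tendsto_id
  have hev := hlim.eventually (det_jacobiField_rpow_le hPt hP hk hU)
  have hdet : ∀ y, (jacobiField P K y).det = (jacobiField P U (y - β)).det *
      (jacobiField P K β).det := fun y => by
    rw [← Matrix.det_mul, ← hadd, add_sub_cancel]
  have hroot : ∀ y, 0 < (jacobiField P U (y - β)).det → (jacobiField P K y).det ^ (1 / n) =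
      g * (jacobiField P U (y - β)).det ^ (1 / n) := fun y hy => by
    rw [hdet, Real.mul_rpow hy.le hβ.le, mul_comm]
  have hg0 : 0 ≤ g := Real.rpow_nonneg hβ.le _
  have hbar0 : detBarrier k n U.trace (P * U).trace 0 = 1 := by simp [detBarrier]
  refine ⟨c, hs, ?_, fun h1 => ?_⟩
  · rw [mul_comm _ g]
    refine hs.mono hbar ?_ (by simp only [sub_self, hbar0, mul_one]; rfl)
    filter_upwards [hev] with y hy
    rw [hroot y hy.1]
    exact mul_le_mul_of_nonneg_left hy.2.1 hg0
  · rw [mul_comm _ g]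
    refine hs.unique (hbar.congr ?_)
    filter_upwards [hev] with y hy
    rw [hroot y hy.1, hy.2.2 h1]

end Jacobi

/-! ### The differential of the transport map -/

lemma hasFDerivAt_vecArctan_zero :
    HasFDerivAt (vecArctan : Eu d → Eu d) (ContinuousLinearMap.id ℝ (Eu d)) 0 := by
  refine .of_isLittleO ?_
  have h1 := (Real.hasDerivAt_arctan 0).isLittleO
  have h2 : Tendsto (fun w : Eu d => ‖w‖) (𝓝 0) (𝓝 0) := by
    simpa using (continuous_norm (E := Eu d)).tendsto 0
  have h3 := h1.comp_tendsto h2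
  refine Asymptotics.IsLittleO.of_norm_norm ((h3.norm_norm).congr (fun w => ?_) fun w => ?_)
  · have e : vecArctan w - vecArctan 0 - (ContinuousLinearMap.id ℝ (Eu d)) (w - 0) =
        (Real.arctan ‖w‖ / ‖w‖ - 1) • w := by
      simp [vecArctan, sub_smul]
    rw [e, norm_smul]
    rcases eq_or_ne w 0 with rfl | hw
    · simp
    · have hr := norm_pos_iff.2 hw
      rw [Real.norm_eq_abs, Real.norm_eq_abs, ← abs_of_pos hr, ← abs_mul, abs_of_pos hr]
      congr 1
      simp
      field_simp
  · simp

/-- The differential scales by arctan(ρ)/ρ across n and by 1/(1+ρ²) along n. The radius ρ is signed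
because the elapsed time may be negative. -/
lemma hasFDerivAt_vecArctan {n : Eu d} (hn : ‖n‖ = 1) {ρ : ℝ} (hρ : ρ ≠ 0) :
    ∃ L : Eu d →L[ℝ] Eu d, HasFDerivAt (vecArctan : Eu d → Eu d) L (ρ • n) ∧ ∀ v, L v =
      (Real.arctan ρ / ρ) • (v - inner ℝ n v • n) + (inner ℝ n v / (1 + ρ ^ 2)) • n := by
  have hn0 : n ≠ 0 := fun h => by simp [h] at hn
  have hw : ρ • n ≠ 0 := smul_ne_zero hρ hn0
  have hr : ‖ρ • n‖ = |ρ| := by rw [norm_smul, hn, mul_one, Real.norm_eq_abs]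
  have hrpos : 0 < |ρ| := abs_pos.2 hρ
  have hnorm : HasFDerivAt (fun w : Eu d => ‖w‖) ((1 / (2 * |ρ|)) • (2 • innerSL ℝ (ρ • n)))
      (ρ • n) := by
    have h1 := (hasStrictFDerivAt_norm_sq (ρ • n)).hasFDerivAt.sqrt (by rw [hr]; positivity)
    simp only [Real.sqrt_sq (norm_nonneg _)] at h1
    rwa [hr] at h1
  have hθ : HasDerivAt (fun r : ℝ => Real.arctan r / r)
      ((1 / (1 + |ρ| ^ 2) * |ρ| - Real.arctan |ρ| * 1) / |ρ| ^ 2) ‖ρ • n‖ := by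
    rw [hr]
    exact (Real.hasDerivAt_arctan |ρ|).div (hasDerivAt_id _) hrpos.ne'
  have hcomp := (hθ.comp_hasFDerivAt (ρ • n) hnorm).smul (hasFDerivAt_id (ρ • n))
  refine ⟨_, hcomp, fun v => ?_⟩
  have harc : Real.arctan |ρ| / |ρ| = Real.arctan ρ / ρ := by
    rcases abs_cases ρ with ⟨h, -⟩ | ⟨h, -⟩ <;> rw [h]
    rw [Real.arctan_neg, neg_div_neg_eq]
  have harc' : Real.arctan |ρ| = Real.arctan ρ / ρ * |ρ| := by
    rw [← harc]; field_simp
  simp only [Function.comp_apply, hr, add_apply,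
    smul_apply, ContinuousLinearMap.smulRight_apply, id_eq,
    ContinuousLinearMap.id_apply, innerSL_apply_apply, smul_eq_mul, real_inner_smul_left,
    harc', sq_abs]
  rw [smul_sub, smul_smul, smul_smul, sub_add_eq_add_sub, add_sub_assoc, ← sub_smul]
  have hρ2 : ρ ^ 2 ≠ 0 := pow_ne_zero 2 hρ
  have e : (1 / (1 + ρ ^ 2) * |ρ| - Real.arctan ρ / ρ * |ρ| * 1) / ρ ^ 2 *
      (1 / (2 * |ρ|) * (2 * (ρ * inner ℝ n v))) * ρ =
      (1 / (1 + ρ ^ 2) - Real.arctan ρ / ρ) * inner ℝ n v * ((|ρ| * (|ρ|)⁻¹) * (ρ ^ 2 / ρ ^ 2)) := by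
    generalize Real.arctan ρ / ρ = A
    field_simp
  rw [mul_inv_cancel₀ hrpos.ne', div_self hρ2] at e
  congr 2
  · exact mul_div_cancel_right₀ _ hrpos.ne'
  · linear_combination e

/-- The projection onto the direction of `p`. -/
noncomputable def dirProj (p : Eu d) : Matrix (Fin d) (Fin d) ℝ :=
  Matrix.vecMulVec (WithLp.ofLp (dir p)) (WithLp.ofLp (dir p))

/-- The matrix of `H`, normalised by the speed of the angular time change. -/
noncomputable def normHess (p : Eu d) (H : Eu d →L[ℝ] Eu d) : Matrix (Fin d) (Fin d) ℝ :=
  (Matrix.toEuclideanCLM (n := Fin d) (𝕜 := ℝ)).symm ((speed p)⁻¹ • H)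

lemma toEuclideanCLM_dirProj (p v : Eu d) :
    Matrix.toEuclideanCLM (n := Fin d) (𝕜 := ℝ) (dirProj p) v = inner ℝ (dir p) v • dir p := by
  apply WithLp.ofLp_injective
  rw [Matrix.ofLp_toEuclideanCLM, dirProj, Matrix.vecMulVec_mulVec]
  ext i
  simp [PiLp.inner_apply, dotProduct, mul_comm]

lemma toEuclideanCLM_normHess (p : Eu d) (H : Eu d →L[ℝ] Eu d) :
    Matrix.toEuclideanCLM (n := Fin d) (𝕜 := ℝ) (normHess p H) = (speed p)⁻¹ • H := by
  simp [normHess]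

lemma dirProj_transpose (p : Eu d) : (dirProj p).transpose = dirProj p := by
  rw [dirProj, Matrix.transpose_vecMulVec]

lemma inner_dir_self_smul (p : Eu d) (a : ℝ) :
    (a * ‖dir p‖ ^ 2) • dir p = a • dir p := by
  by_cases hp : p = 0
  · simp [hp, dir_zero]
  · rw [norm_dir_of_ne hp]; simp

lemma dirProj_mul_self (p : Eu d) : dirProj p * dirProj p = dirProj p := by
  apply EquivLike.injective (Matrix.toEuclideanCLM (n := Fin d) (𝕜 := ℝ))
  ext1 v
  rw [map_mul, mul_apply_eq_comp, toEuclideanCLM_dirProj, toEuclideanCLM_dirProj,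
    real_inner_smul_right, real_inner_self_eq_norm_sq, inner_dir_self_smul]

lemma det_blockScalar_dirProj (p : Eu d) (a : ℝ) :
    (blockScalar (dirProj p) a 1).det = 1 + (a - 1) * ‖dir p‖ ^ 2 := by
  have e : blockScalar (dirProj p) a 1 = 1 + Matrix.replicateCol Unit ((a - 1) • (dir p).ofLp) *
      Matrix.replicateRow Unit (dir p).ofLp := by
    ext i j
    simp [blockScalar, dirProj, Matrix.vecMulVec_apply, Matrix.mul_apply]
    ring
  rw [e, Matrix.det_one_add_replicateCol_mul_replicateRow, dotProduct_smul, smul_eq_mul,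
    EuclideanSpace.real_norm_sq_eq]
  simp [dotProduct, sq]

lemma normHess_transpose (p : Eu d) {H : Eu d →L[ℝ] Eu d}
    (hH : ∀ v w, inner ℝ (H v) w = inner ℝ (H w) v) :
    (normHess p H).transpose = normHess p H := by
  rw [← Matrix.conjTranspose_eq_transpose_of_trivial, ← Matrix.star_eq_conjTranspose]
  apply EquivLike.injective (Matrix.toEuclideanCLM (n := Fin d) (𝕜 := ℝ))
  rw [map_star, toEuclideanCLM_normHess]
  refine ContinuousLinearMap.isSelfAdjoint_iff_isSymmetric.2 fun v w => ?_
  simp only [ContinuousLinearMap.coe_coe, smul_apply, real_inner_smul_left,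
    real_inner_smul_right]
  rw [hH v w, real_inner_comm]

lemma toEuclideanCLM_blockScalar (p v : Eu d) (a b : ℝ) :
    Matrix.toEuclideanCLM (n := Fin d) (𝕜 := ℝ) (blockScalar (dirProj p) a b) v =
      a • (inner ℝ (dir p) v • dir p) + b • (v - inner ℝ (dir p) v • dir p) := by
  simp only [blockScalar, map_add, map_smul, map_sub, map_one, add_apply,
    smul_apply, sub_apply, toEuclideanCLM_dirProj,
    one_apply_eq_self]

/-- The differential of the transport map over the time `τ`, as a matrix. -/
noncomputable def transportMatrix (f : ℝ) (p : Eu d) (H : Eu d →L[ℝ] Eu d) (τ : ℝ) :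
    Matrix (Fin d) (Fin d) ℝ :=
  jacobiField (dirProj p) (normHess p H) (angle f p τ)

lemma toEuclideanCLM_transportMatrix (f : ℝ) (p : Eu d) (H : Eu d →L[ℝ] Eu d) (τ : ℝ) (v : Eu d) :
    Matrix.toEuclideanCLM (n := Fin d) (𝕜 := ℝ) (transportMatrix f p H τ) v =
      (Real.cos (2 * angle f p τ) * inner ℝ (dir p) v) • dir p +
        (v - inner ℝ (dir p) v • dir p) +
      ((Real.sin (2 * angle f p τ) / 2 * ((speed p)⁻¹ * inner ℝ (dir p) (H v))) • dir p +
        (angle f p τ) • ((speed p)⁻¹ • H v - ((speed p)⁻¹ * inner ℝ (dir p) (H v)) • dir p)) := by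
  rw [transportMatrix, jacobiField, map_add, map_mul, add_apply,
    mul_apply_eq_comp, toEuclideanCLM_normHess, toEuclideanCLM_blockScalar,
    toEuclideanCLM_blockScalar, smul_apply, real_inner_smul_right, smul_smul,
    smul_smul, one_smul]

lemma det_toEuclideanCLM (M : Matrix (Fin d) (Fin d) ℝ) :
    (Matrix.toEuclideanCLM (n := Fin d) (𝕜 := ℝ) M).det = M.det := by
  rw [ContinuousLinearMap.det, Matrix.coe_toEuclideanCLM_eq_toEuclideanLin,
    Matrix.toEuclideanLin_eq_toLin_orthonormal, LinearMap.det_toLin]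

/-- With tan β = τ|p|/a, the differential of the arctangent multiplies the component along p by
cos²β, which produces cos 2β and sin 2β / 2, and turns the factor tan β across p into β. If p = 0 or
τ = 0, the arctangent is differentiated at the origin, where its differential is the identity. -/
lemma hasFDerivWithinAt_transport {S : Set (Eu d)} {x : Eu d} {f : Eu d → ℝ} {G : Eu d → Eu d}
    (hf : HasGradientAt f (G x) x) {H : Eu d →L[ℝ] Eu d} (hH : HasFDerivWithinAt G H S x) {τ : ℝ}
    (ha : 0 < 1 + 2 * τ * f x) :
    HasFDerivWithinAt (fun z => z + vecArctan ((τ / (1 + 2 * τ * f z)) • G z))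
      (Matrix.toEuclideanCLM (n := Fin d) (𝕜 := ℝ) (transportMatrix (f x) (G x) H τ)) S x := by
  set p := G x with hp
  set a := 1 + 2 * τ * f x with ha_def
  have hfd : HasFDerivAt f (innerSL ℝ p) x := by
    have := hasGradientAt_iff_hasFDerivAt.1 hf
    refine this.congr_fderiv ?_
    ext v
    simp
  have hm : HasFDerivWithinAt (fun z => τ / (1 + 2 * τ * f z))
      (-(2 * τ ^ 2 / a ^ 2) • innerSL ℝ p) S x := by
    have h1 := (((hasDerivAt_inv ha.ne').comp_hasFDerivAt x
      ((hfd.const_mul (2 * τ)).const_add 1)).const_mul τ).hasFDerivWithinAt (s := S)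
    refine (h1.congr_fderiv ?_).congr (fun z _ => div_eq_mul_inv _ _)
      (div_eq_mul_inv _ _)
    ext v
    simp
    field_simp
  have hW := hm.smul hH
  have hid := hasFDerivWithinAt_id (𝕜 := ℝ) x S
  have fin : ∀ A : Eu d →L[ℝ] Eu d, HasFDerivAt vecArctan A ((τ / a) • p) →
      (∀ v, v + A ((τ / a) • H v + (-(2 * τ ^ 2 / a ^ 2) * inner ℝ p v) • p) =
        Matrix.toEuclideanCLM (n := Fin d) (𝕜 := ℝ) (transportMatrix (f x) p H τ) v) →
      HasFDerivWithinAt (fun z => z + vecArctan ((τ / (1 + 2 * τ * f z)) • G z))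
      (Matrix.toEuclideanCLM (n := Fin d) (𝕜 := ℝ) (transportMatrix (f x) p H τ)) S x := by
    intro A hA hv
    have h2 := hid.add (HasFDerivAt.comp_hasFDerivWithinAt x (by exact hA) hW)
    refine h2.congr_fderiv ?_
    ext1 v
    rw [← hv]
    simp
    rfl
  have hangle0 : p ≠ 0 → Real.tan (angle (f x) p τ) = τ * ‖p‖ / a := fun h => by
    rw [angle, if_neg h, Real.tan_arctan]
  by_cases hp0 : p = 0
  · refine fin _ (by rw [hp0, smul_zero]; exact hasFDerivAt_vecArctan_zero) fun v => ?_
    rw [toEuclideanCLM_transportMatrix, hp0, dir_zero, angle, if_pos rfl, speed, if_pos rfl]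
    simp [ha_def]
  have hpn : 0 < ‖p‖ := norm_pos_iff.2 hp0
  have hpdir : p = ‖p‖ • dir p := by
    rw [dir, speed_of_ne hp0, smul_smul, mul_inv_cancel₀ hpn.ne', one_smul]
  set n := dir p with hn
  have hn1 : ‖n‖ = 1 := norm_dir_of_ne hp0
  rcases eq_or_ne τ 0 with hτ | hτ
  · refine fin _ (by rw [hτ, zero_div, zero_smul]; exact hasFDerivAt_vecArctan_zero) fun v => ?_
    have hang : angle (f x) p τ = 0 := by rw [angle, if_neg hp0, hτ]; simp
    rw [toEuclideanCLM_transportMatrix, hang, hτ]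
    simp
  · set β := angle (f x) p τ with hβ
    have htan := hangle0 hp0
    have hρ : Real.tan β ≠ 0 := by rw [htan]; positivity
    have hβ2 : -(Real.pi / 2) < β ∧ β < Real.pi / 2 := by
      rw [hβ, angle, if_neg hp0]
      exact ⟨Real.neg_pi_div_two_lt_arctan _, Real.arctan_lt_pi_div_two _⟩
    have hcos : Real.cos β ≠ 0 := (Real.cos_pos_of_mem_Ioo hβ2).ne'
    have hw : (τ / a) • p = Real.tan β • n := by
      rw [htan, hpdir, smul_smul, ← hpdir]; congr 1; ring
    obtain ⟨L, hL, hLv⟩ := hasFDerivAt_vecArctan hn1 hρ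
    refine fin L (by rw [hw]; exact hL) fun v => ?_
    have harg : (τ / a) • H v + (-(2 * τ ^ 2 / a ^ 2) * inner ℝ p v) • p =
        Real.tan β • (‖p‖⁻¹ • H v) - (2 * Real.tan β ^ 2 * inner ℝ n v) • n := by
      have hip : inner ℝ p v = ‖p‖ * inner ℝ n v := by
        conv_lhs => rw [hpdir]
        rw [real_inner_smul_left]
      have hmp : ∀ b : ℝ, b • p = (b * ‖p‖) • n := fun b => by rw [mul_smul, ← hpdir]
      rw [htan, hip, hmp, smul_smul, sub_eq_add_neg, ← neg_smul]
      congr 2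
      · field_simp
      · field_simp
    rw [harg, hLv, toEuclideanCLM_transportMatrix, ← hβ, ← hn, speed_of_ne hp0,
      Real.arctan_tan hβ2.1 hβ2.2]
    have hkn : ‖p‖⁻¹ * inner ℝ n (H v) = inner ℝ n (‖p‖⁻¹ • H v) := by
      rw [real_inner_smul_right]
    rw [hkn]
    generalize ‖p‖⁻¹ • H v = k
    rw [ inner_sub_right, real_inner_smul_right, real_inner_smul_right,
      real_inner_self_eq_norm_sq, hn1]
    have e1 : 1 + Real.tan β ^ 2 = (Real.cos β ^ 2)⁻¹ := by
      rw [← Real.inv_one_add_tan_sq hcos, inv_inv]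
    have e2 : (Real.tan β * inner ℝ n k - 2 * Real.tan β ^ 2 * inner ℝ n v * 1 ^ 2) /
        (1 + Real.tan β ^ 2) =
        Real.sin (2 * β) / 2 * inner ℝ n k + (Real.cos (2 * β) - 1) * inner ℝ n v := by
      rw [e1, Real.tan_eq_sin_div_cos, Real.sin_two_mul, Real.cos_two_mul', Real.cos_sq' β]
      have : Real.cos β ^ 2 = 1 - Real.sin β ^ 2 := Real.cos_sq' β
      rw [← this]
      field_simp
      linear_combination (-inner ℝ n v) * this
    rw [e2]
    have e3 : Real.tan β • k - (2 * Real.tan β ^ 2 * inner ℝ n v) • n -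
        (Real.tan β * inner ℝ n k - 2 * Real.tan β ^ 2 * inner ℝ n v * 1 ^ 2) • n =
        Real.tan β • (k - inner ℝ n k • n) := by
      module
    rw [e3, smul_smul, div_mul_cancel₀ _ hρ]
    module

/-! ### Positivity of the determinant -/

lemma jacobiField_neg {ι : Type*} [Fintype ι] [DecidableEq ι] (P K : Matrix ι ι ℝ) (β : ℝ) :
    jacobiField P (-K) (-β) = jacobiField P K β := by
  rw [jacobiField, jacobiField, show 2 * -β = -(2 * β) by ring, Real.cos_neg, Real.sin_neg,
    neg_div, ← blockScalar_neg, neg_mul_neg]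

/-- Time reversal: changing the sign of ξ_s together with the elapsed time leaves the differential
unchanged. Times before s thereby reduce to times after s. -/
lemma transportMatrix_neg (f : ℝ) (p : Eu d) (H : Eu d →L[ℝ] Eu d) (τ : ℝ) :
    transportMatrix (-f) (-p) (-H) (-τ) = transportMatrix f p H τ := by
  have h1 : dirProj (-p) = dirProj p := by
    rw [dirProj, dirProj, dir_neg, WithLp.ofLp_neg, Matrix.neg_vecMulVec, Matrix.vecMulVec_neg,
      neg_neg]
  have h2 : normHess (-p) (-H) = -normHess p H := by
    rw [normHess, normHess, speed_neg, smul_neg, map_neg]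
  rw [transportMatrix, transportMatrix, h1, h2, angle_neg, jacobiField_neg]

lemma transportMatrix_zero (f : ℝ) (p : Eu d) (H : Eu d →L[ℝ] Eu d) :
    transportMatrix f p H 0 = 1 := by
  have : angle f p 0 = 0 := by simp [angle]
  simp [transportMatrix, this, jacobiField, blockScalar]

lemma posDef_of_inner_pos {M : Matrix (Fin d) (Fin d) ℝ} (hM : M.transpose = M)
    (h : ∀ v : Eu d, v ≠ 0 →
      0 < inner ℝ v (Matrix.toEuclideanCLM (n := Fin d) (𝕜 := ℝ) M v)) : M.PosDef := by
  refine Matrix.PosDef.of_dotProduct_mulVec_pos ?_ fun v hv => ?_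
  · rw [Matrix.IsHermitian, Matrix.conjTranspose_eq_transpose_of_trivial, hM]
  · have := h (WithLp.toLp 2 v) (by simpa using hv)
    rwa [Matrix.inner_toEuclideanCLM] at this

lemma inner_blockScalar (p v : Eu d) (a b : ℝ) :
    inner ℝ v (Matrix.toEuclideanCLM (n := Fin d) (𝕜 := ℝ) (blockScalar (dirProj p) a b) v) =
      a * inner ℝ (dir p) v ^ 2 + b * (‖v‖ ^ 2 - inner ℝ (dir p) v ^ 2) := by
  rw [toEuclideanCLM_blockScalar, inner_add_right, real_inner_smul_right, real_inner_smul_right,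
    real_inner_smul_right, inner_sub_right, real_inner_smul_right, real_inner_self_eq_norm_sq,
    real_inner_comm]
  ring

lemma det_blockScalar_pos (p : Eu d) {a b : ℝ} (ha : 0 < a) (hb : 0 < b) :
    0 < (blockScalar (dirProj p) a b).det := by
  refine (posDef_of_inner_pos (blockScalar_transpose (dirProj_transpose p) a b)
    fun v hv => ?_).det_pos
  rw [inner_blockScalar]
  have hv' : 0 < ‖v‖ ^ 2 := by have := norm_pos_iff.2 hv; positivity
  have h1 := inner_dir_sq_le p v
  rcases (sq_nonneg (inner ℝ (dir p) v)).lt_or_eq with h | h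
  · have e1 := mul_nonneg hb.le (sub_nonneg.2 h1)
    have e2 := mul_pos ha h
    linarith
  · rw [← h]
    have e1 := mul_pos hb hv'
    linarith

lemma det_transportMatrix_pos_of_quadForm {f : ℝ} {p : Eu d} {H : Eu d →L[ℝ] Eu d}
    (hH : ∀ v w, inner ℝ (H v) w = inner ℝ (H w) v) {τ : ℝ} (hβ : 0 < angle f p τ)
    (hpos : ∀ w : Eu d, w ≠ 0 → 0 < inner ℝ (H w) w / speed p +
      2 * Real.cos (2 * angle f p τ) / Real.sin (2 * angle f p τ) * inner ℝ (dir p) w ^ 2 +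
      (angle f p τ)⁻¹ * (‖w‖ ^ 2 - inner ℝ (dir p) w ^ 2)) :
    0 < (transportMatrix f p H τ).det := by
  set β := angle f p τ with hβ_def
  set K := normHess p H with hK_def
  set c := 2 * Real.cos (2 * β) / Real.sin (2 * β)
  have hpd : (K + blockScalar (dirProj p) c β⁻¹).PosDef := by
    refine posDef_of_inner_pos ?_ fun v hv => ?_
    · rw [Matrix.transpose_add, normHess_transpose p hH,
        blockScalar_transpose (dirProj_transpose p)]
    · rw [map_add, add_apply, inner_add_right, inner_blockScalar, hK_def, toEuclideanCLM_normHess,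
        smul_apply, real_inner_smul_right, real_inner_comm]
      have := hpos v hv
      rw [div_eq_inv_mul] at this
      linarith
  have hP := dirProj_mul_self p
  -- The Jacobi field factors as diag(sin 2β / 2, β) times K + diag(2 cot 2β, 1/β). If p = 0 the
  -- projection vanishes, so a is irrelevant and 1 serves.
  obtain ⟨a, ha, hfac⟩ : ∃ a > 0, transportMatrix f p H τ =
      blockScalar (dirProj p) a β * (K + blockScalar (dirProj p) c β⁻¹) := by
    have hmul : ∀ a, blockScalar (dirProj p) a β * (K + blockScalar (dirProj p) c β⁻¹) =
        blockScalar (dirProj p) (a * c) 1 + blockScalar (dirProj p) a β * K := fun a => by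
      rw [mul_add, blockScalar_mul hP, mul_inv_cancel₀ hβ.ne', add_comm]
    by_cases hp : p = 0
    · refine ⟨1, one_pos, ?_⟩
      have h0 : dirProj p = 0 := by
        rw [dirProj, hp, dir_zero, WithLp.ofLp_zero, Matrix.zero_vecMulVec]
      rw [hmul, transportMatrix, jacobiField, h0]
      simp only [blockScalar, smul_zero]
      rfl
    · have hlt : β < Real.pi / 2 := by
        rw [hβ_def, angle, if_neg hp]
        exact Real.arctan_lt_pi_div_two _
      have hs : 0 < Real.sin (2 * β) :=
        Real.sin_pos_of_pos_of_lt_pi (by linarith) (by linarith)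
      refine ⟨Real.sin (2 * β) / 2, by positivity, ?_⟩
      rw [hmul, transportMatrix, jacobiField,
        show Real.sin (2 * β) / 2 * c = Real.cos (2 * β) by simp only [c]; field_simp]
  rw [hfac, Matrix.det_mul]
  exact mul_pos (det_blockScalar_pos p ha hβ) hpd.det_pos

/-! ### The time change -/

/-- The dilation factor as a function of the elapsed time. -/
noncomputable def dilationFun (f N τ : ℝ) : ℝ := √((1 + 2 * τ * f) ^ 2 + τ ^ 2 * N)

lemma hasDerivAt_dilationSq (f N τ : ℝ) :
    HasDerivAt (fun τ : ℝ => (1 + 2 * τ * f) ^ 2 + τ ^ 2 * N)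
      (2 * (2 * f * (1 + 2 * τ * f) + τ * N)) τ := by
  have h1 : HasDerivAt (fun τ : ℝ => 1 + 2 * τ * f) (2 * f) τ := by
    simpa using (((hasDerivAt_id τ).const_mul 2).mul_const f).const_add 1
  refine ((h1.fun_pow 2).add ((hasDerivAt_pow 2 τ).mul_const N)).congr_deriv ?_
  norm_num; ring

lemma hasDerivAt_dilationFun {f N τ : ℝ} (h : 0 < (1 + 2 * τ * f) ^ 2 + τ ^ 2 * N) :
    HasDerivAt (dilationFun f N) ((2 * f * (1 + 2 * τ * f) + τ * N) / dilationFun f N τ) τ := by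
  refine ((hasDerivAt_dilationSq f N τ).sqrt h.ne').congr_deriv ?_
  rw [dilationFun, mul_div_mul_left _ _ two_ne_zero]

/-- Writing a = 1 + 2τf, the numerator (4f² + N)q² - (2fa + τN)² equals N(a - 2τf)² = N. -/
lemma hasDerivAt_dilationFun_deriv {f N τ : ℝ} (h : 0 < (1 + 2 * τ * f) ^ 2 + τ ^ 2 * N) :
    HasDerivAt (fun τ => (2 * f * (1 + 2 * τ * f) + τ * N) / dilationFun f N τ)
      (N / dilationFun f N τ ^ 3) τ := by
  have hq : 0 < dilationFun f N τ := Real.sqrt_pos.2 h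
  have hq2 : dilationFun f N τ ^ 2 = (1 + 2 * τ * f) ^ 2 + τ ^ 2 * N := Real.sq_sqrt h.le
  have h1 : HasDerivAt (fun τ : ℝ => 2 * f * (1 + 2 * τ * f) + τ * N) (4 * f ^ 2 + N) τ := by
    refine ((((((hasDerivAt_id τ).const_mul 2).mul_const f).const_add 1).const_mul (2 * f)).add
      ((hasDerivAt_id τ).mul_const N)).congr_deriv ?_
    ring
  refine (h1.div (hasDerivAt_dilationFun h) hq.ne').congr_deriv ?_
  field_simp
  rw [hq2]
  ring

lemma hasDerivAt_angle {f : ℝ} {p : Eu d} {τ : ℝ} (h : 0 < 1 + 2 * τ * f) :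
    HasDerivAt (angle f p) (speed p / dilationFun f (‖p‖ ^ 2) τ ^ 2) τ := by
  have hq2 : dilationFun f (‖p‖ ^ 2) τ ^ 2 = (1 + 2 * τ * f) ^ 2 + τ ^ 2 * ‖p‖ ^ 2 :=
    Real.sq_sqrt (by positivity)
  have h1 : HasDerivAt (fun τ : ℝ => 1 + 2 * τ * f) (2 * f) τ := by
    simpa using (((hasDerivAt_id τ).const_mul 2).mul_const f).const_add 1
  rw [hq2]
  by_cases hp : p = 0
  · have e : angle f p = fun τ => τ / (1 + 2 * τ * f) := by
      funext τ; rw [angle, if_pos hp]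
    rw [e, speed, if_pos hp, hp]
    refine ((hasDerivAt_id τ).div h1 h.ne').congr_deriv ?_
    simp
    ring
  · have e : angle f p = fun τ => Real.arctan (τ * ‖p‖ / (1 + 2 * τ * f)) := by
      funext τ; rw [angle, if_neg hp]
    rw [e, speed_of_ne hp]
    refine ((((hasDerivAt_id τ).mul_const ‖p‖).div h1 h.ne').arctan).congr_deriv ?_
    have hne : (1 + 2 * τ * f) ^ 2 + τ ^ 2 * ‖p‖ ^ 2 ≠ 0 := by positivity
    have h2 : 1 + (τ * ‖p‖ / (1 + 2 * τ * f)) ^ 2 =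
        ((1 + 2 * τ * f) ^ 2 + τ ^ 2 * ‖p‖ ^ 2) / (1 + 2 * τ * f) ^ 2 := by
      rw [div_pow, mul_pow, eq_div_iff (by positivity), add_mul, div_mul_cancel₀ _ (by positivity),
        one_mul]
    simp only [id, Pi.div_apply]
    rw [h2]
    field_simp
    ring

lemma contDiffAt_angle {f : ℝ} {p : Eu d} {τ : ℝ} (h : 0 < 1 + 2 * τ * f) :
    ContDiffAt ℝ 2 (angle f p) τ := by
  have h1 : ContDiffAt ℝ 2 (fun τ : ℝ => 1 + 2 * τ * f) τ := by fun_prop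
  by_cases hp : p = 0
  · have e : angle f p = fun τ => τ / (1 + 2 * τ * f) := by
      funext τ; rw [angle, if_pos hp]
    rw [e]
    exact contDiffAt_id.div h1 h.ne'
  · have e : angle f p = fun τ => Real.arctan (τ * ‖p‖ / (1 + 2 * τ * f)) := by
      funext τ; rw [angle, if_neg hp]
    rw [e]
    exact Real.contDiff_arctan.contDiffAt.comp τ ((contDiffAt_id.mul contDiffAt_const).div h1 h.ne')

lemma contDiffAt_dilationFun {f N τ : ℝ} (h : 0 < (1 + 2 * τ * f) ^ 2 + τ ^ 2 * N) :
    ContDiffAt ℝ 2 (dilationFun f N) τ := by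
  refine ContDiffAt.sqrt ?_ h.ne'
  fun_prop

/-- The first derivative is q'g(β) + c g'(β)/q. On differentiating again, the two terms containing
q'g' cancel, exactly because β' = c/q². -/
lemma hasSecondDerivAt_timeChange {q q₁ β g : ℝ → ℝ} {q₂ c g₂ τ : ℝ}
    (hq : ∀ᶠ y in 𝓝 τ, HasDerivAt q (q₁ y) y) (hq₁ : HasDerivAt q₁ q₂ τ)
    (hpos : ∀ᶠ y in 𝓝 τ, 0 < q y) (hβ : ∀ᶠ y in 𝓝 τ, HasDerivAt β (c / q y ^ 2) y)
    (hg : HasSecondDerivAt g g₂ (β τ)) :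
    HasSecondDerivAt (fun y => q y * g (β y)) (q₂ * g (β τ) + g₂ * c ^ 2 / q τ ^ 3) τ := by
  obtain ⟨g', h1, h2⟩ := hg
  have hβ0 := hβ.self_of_nhds
  have hp0 := hpos.self_of_nhds
  have hq0 := hq.self_of_nhds
  have h1' := hβ0.continuousAt.eventually h1
  refine ⟨fun y => q₁ y * g (β y) + c * (g' (β y) * (q y)⁻¹), ?_, ?_⟩
  · filter_upwards [hq, hpos, hβ, h1'] with y e1 e2 e3 e4
    refine (e1.mul (e4.comp y e3)).congr_deriv ?_
    simp only [Function.comp_apply]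
    field_simp
  · refine ((hq₁.mul (h1.self_of_nhds.comp τ hβ0)).add
      (((h2.comp τ hβ0).mul (hq0.inv hp0.ne')).const_mul c)).congr_deriv ?_
    simp only [Function.comp_apply, Pi.inv_apply]
    field_simp
    ring

/-! ### Geometry at the contact points -/

lemma contactSet_quadratic_bound {φ₀ φ₁ : Eu d → EReal} (hφ₀ : LowerSemicontinuous φ₀)
    (hφ₁ : UpperSemicontinuous φ₁)
    (h : ∀ x₀ x₁ : Eu d, ‖x₀ - x₁‖ < Real.pi / 2 → φ₁ x₁ ≤ cost (x₁ - x₀) + φ₀ x₀)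
    {s : ℝ} (hs : s ∈ Ioo (0 : ℝ) 1) {y : Eu d} (hy : y ∈ contactSet φ₀ φ₁ s) :
    (∃ κ ≥ 0, ∃ z, TouchedBelow (1 - s) κ z (pot φ₀ s) y ∧
      gradPot φ₀ s y = (κ / (2 * (1 - s))) • cosSqGrad (y - z)) ∧
    (∃ κ ≥ 0, ∃ z, TouchedBelow s κ z (fun z => -pot φ₀ s z) y ∧
      -gradPot φ₀ s y = (κ / (2 * s)) • cosSqGrad (y - z)) ∧
    HasGradientAt (pot φ₀ s) (gradPot φ₀ s y) y ∧
    ∀ z, |pot φ₀ s z - pot φ₀ s y - inner ℝ (gradPot φ₀ s y) (z - y)| ≤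
      1 / (2 * s * (1 - s)) * ‖z - y‖ ^ 2 := by
  have hs0 := hs.1
  have hs1 : 0 < 1 - s := by linarith [hs.2]
  obtain ⟨κ₁, hκ₁, y₁, ht₁⟩ := exists_touchedBelow_pot hφ₀ hφ₁ h hs hy
  obtain ⟨κ₀, hκ₀, y₀, ht₀⟩ := exists_touchedBelow_neg_pot hφ₀ hs y
  -- The bounds κ₁ ≤ 1/s and κ₀ ≤ 1/(1-s) give one remainder constant for all contact points, which
  -- the blow-up argument requires.
  have hC₁ : κ₁ / (2 * (1 - s)) ≤ 1 / (2 * s * (1 - s)) := by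
    calc κ₁ / (2 * (1 - s)) ≤ s⁻¹ / (2 * (1 - s)) := by gcongr; exact hκ₁.2
      _ = _ := by field_simp
  have hC₀ : κ₀ / (2 * s) ≤ 1 / (2 * s * (1 - s)) := by
    calc κ₀ / (2 * s) ≤ (1 - s)⁻¹ / (2 * s) := by gcongr; exact hκ₀.2
      _ = _ := by field_simp
  obtain ⟨e1, e2, e3, e4⟩ := quadratic_bound_of_touched ht₁ ht₀ hs1 hs0 hκ₁.1 hκ₀.1 hC₁ hC₀
  exact ⟨⟨κ₁, hκ₁.1, y₁, ht₁, e1⟩, ⟨κ₀, hκ₀.1, y₀, ht₀, by rw [gradPot, e2, neg_neg]⟩, e3, e4⟩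

/-- The differential of the transport map at the points of `domHess`. -/
lemma exists_transport_differential (hd : 1 ≤ d) {φ₀ φ₁ : Eu d → EReal}
    (hφ₀ : LowerSemicontinuous φ₀) (hφ₁ : UpperSemicontinuous φ₁)
    (h : ∀ x₀ x₁ : Eu d, ‖x₀ - x₁‖ < Real.pi / 2 → φ₁ x₁ ≤ cost (x₁ - x₀) + φ₀ x₀)
    {s : ℝ} (hs : s ∈ Ioo (0 : ℝ) 1) {x : Eu d} (hx : x ∈ domHess φ₀ φ₁ s) :
    ∃ H : Eu d →L[ℝ] Eu d, (∀ v w, inner ℝ (H v) w = inner ℝ (H w) v) ∧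
      ∀ t ∈ Ioo (0 : ℝ) 1, 0 < 1 + 2 * (t - s) * pot φ₀ s x ∧
        DifferentiableWithinAt ℝ (transport φ₀ s t) (contactSet φ₀ φ₁ s) x ∧
        detTransport φ₀ φ₁ s t x = (transportMatrix (pot φ₀ s x) (gradPot φ₀ s x) H (t - s)).det ∧
        0 < (transportMatrix (pot φ₀ s x) (gradPot φ₀ s x) H (t - s)).det := by
  obtain ⟨hxS, hdens, hdiff⟩ := hx
  have hS := hdens.fullTangent hd
  have hs0 := hs.1
  have hs1 : 0 < 1 - s := by linarith [hs.2]
  have hC : 0 ≤ 1 / (2 * s * (1 - s)) := by positivity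
  have hb : ∀ y ∈ contactSet φ₀ φ₁ s, ∀ z,
      |pot φ₀ s z - pot φ₀ s y - inner ℝ (gradPot φ₀ s y) (z - y)| ≤
        1 / (2 * s * (1 - s)) * ‖z - y‖ ^ 2 := fun y hy =>
    (contactSet_quadratic_bound hφ₀ hφ₁ h hs hy).2.2.2
  obtain ⟨⟨κ₁, hκ₁, y₁, ht₁, hG₁⟩, ⟨κ₀, hκ₀, y₀, ht₀, hG₀⟩, hgrad, -⟩ :=
    contactSet_quadratic_bound hφ₀ hφ₁ h hs hxS
  set H := fderivWithin ℝ (gradPot φ₀ s) (contactSet φ₀ φ₁ s) x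
  have hH : HasFDerivWithinAt (gradPot φ₀ s) H (contactSet φ₀ φ₁ s) x := hdiff.hasFDerivWithinAt
  have hsymm := (second_order_expansion hS hxS hC hb hH).1
  refine ⟨H, hsymm, fun t ht => ?_⟩
  have hbneg : ∀ y ∈ contactSet φ₀ φ₁ s, ∀ z,
      |-pot φ₀ s z - -pot φ₀ s y - inner ℝ (-gradPot φ₀ s y) (z - y)| ≤
        1 / (2 * s * (1 - s)) * ‖z - y‖ ^ 2 := fun y hy z => by
    have := hb y hy z
    rw [← abs_neg] at this
    refine le_of_eq_of_le (congrArg _ ?_) this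
    rw [inner_neg_left]; ring
  have hpos : 0 < 1 + 2 * (t - s) * pot φ₀ s x ∧
      0 < (transportMatrix (pot φ₀ s x) (gradPot φ₀ s x) H (t - s)).det := by
    rcases lt_trichotomy t s with hts | hts | hts
    -- Before s, the roles pass to -ξ_s, which is touched from below by a profile with touching time
    -- s.
    · have hσ : s - t ∈ Ioo 0 s := ⟨by linarith, by linarith [ht.1]⟩
      have h1 := ht₀.one_add_pos hκ₀ hσ
      obtain ⟨h2, h3⟩ := ht₀.quadForm_pos hS hxS (G := fun z => -gradPot φ₀ s z) hC hbneg hH.neg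
        hκ₀ hG₀ hσ
      refine ⟨by linarith, ?_⟩
      rw [← transportMatrix_neg, neg_sub]
      refine det_transportMatrix_pos_of_quadForm (fun v w => ?_) h2 h3
      simp only [neg_apply, inner_neg_left, hsymm v w]
    · rw [hts, sub_self, transportMatrix_zero, Matrix.det_one]
      norm_num
    · have hσ : t - s ∈ Ioo 0 (1 - s) := ⟨by linarith, by linarith [ht.2]⟩
      obtain ⟨h2, h3⟩ := ht₁.quadForm_pos hS hxS hC hb hH hκ₁ hG₁ hσ
      exact ⟨ht₁.one_add_pos hκ₁ hσ, det_transportMatrix_pos_of_quadForm hsymm h2 h3⟩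
  have hT := hasFDerivWithinAt_transport hgrad hH hpos.1
  refine ⟨hpos.1, hT.differentiableWithinAt, ?_, hpos.2⟩
  rw [← det_toEuclideanCLM, ← hT.fderivWithin (hS.uniqueDiffWithinAt hxS)]
  rfl

end HellKant

/-! ### The curvature estimates -/

theorem proposition5p6 (d : ℕ) (hd : 1 ≤ d)
    (μ : ℝ → FiniteMeasure (HellKant.Eu d)) (hμ : HellKant.IsGeodesic μ)
    (φ₀ φ₁ : HellKant.Eu d → EReal)
    (hφ : HellKant.IsTightOptimalPair (μ 0) (μ 1) φ₀ φ₁)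
    (s : ℝ) (hs : s ∈ Ioo (0 : ℝ) 1)
    (x : HellKant.Eu d) (hx : x ∈ HellKant.domHess φ₀ φ₁ s) :
    ContDiffOn ℝ 2 (fun r : ℝ => HellKant.gammaFun φ₀ s r x) (Ioo 0 1) ∧
    ContDiffOn ℝ 2 (fun r : ℝ => HellKant.rhoFun φ₀ φ₁ s r x) (Ioo 0 1) ∧
    ∀ t ∈ Ioo (0 : ℝ) 1,
      DifferentiableWithinAt ℝ (HellKant.transport φ₀ s t) (HellKant.contactSet φ₀ φ₁ s) x ∧
      0 < HellKant.detTransport φ₀ φ₁ s t x ∧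
      0 < HellKant.gammaFun φ₀ s t x ∧
      0 < HellKant.rhoFun φ₀ φ₁ s t x ∧
      0 ≤ iteratedDeriv 2 (fun r : ℝ => HellKant.gammaFun φ₀ s r x) t /
          HellKant.gammaFun φ₀ s t x ∧
      (2 ≤ d →
        iteratedDeriv 2 (fun r : ℝ => HellKant.rhoFun φ₀ φ₁ s r x) t /
            HellKant.rhoFun φ₀ φ₁ s t x ≤
          (1 - 4 / (d : ℝ)) *
            (iteratedDeriv 2 (fun r : ℝ => HellKant.gammaFun φ₀ s r x) t /
              HellKant.gammaFun φ₀ s t x)) ∧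
      (d = 1 →
        iteratedDeriv 2 (fun r : ℝ => HellKant.rhoFun φ₀ φ₁ s r x) t /
            HellKant.rhoFun φ₀ φ₁ s t x =
          (1 - 4 / (d : ℝ)) *
            (iteratedDeriv 2 (fun r : ℝ => HellKant.gammaFun φ₀ s r x) t /
              HellKant.gammaFun φ₀ s t x)) := by
  obtain ⟨H, hsymm, hall⟩ :=
    HellKant.exists_transport_differential hd hφ.lsc hφ.usc hφ.le_cost hs hx
  have hd0 : (0 : ℝ) < d := by exact_mod_cast hd
  have : Nonempty (Fin d) := ⟨⟨0, hd⟩⟩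
  set f := HellKant.pot φ₀ s x
  set p := HellKant.gradPot φ₀ s x
  set q : ℝ → ℝ := HellKant.dilationFun f (‖p‖ ^ 2)
  set β : ℝ → ℝ := HellKant.angle f p
  set P := HellKant.dirProj p
  set K := HellKant.normHess p H
  set g : ℝ → ℝ := fun β => (HellKant.jacobiField P K β).det ^ (1 / (d : ℝ)) with hg
  have hγ : (fun r : ℝ => HellKant.gammaFun φ₀ s r x) = fun r => q (r - s) := rfl
  have hρ : ∀ r ∈ Ioo (0 : ℝ) 1, HellKant.rhoFun φ₀ φ₁ s r x = q (r - s) * g (β (r - s)) := by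
    intro r hr
    rw [HellKant.rhoFun, (hall r hr).2.2.1]
    rfl
  have hqpos : ∀ {τ : ℝ}, 0 < 1 + 2 * τ * f → 0 < (1 + 2 * τ * f) ^ 2 + τ ^ 2 * ‖p‖ ^ 2 :=
    fun h => by positivity
  have hsub : ∀ t : ℝ, ContDiffAt ℝ 2 (fun r : ℝ => r - s) t := fun t => by fun_prop
  have hsmooth : ∀ t ∈ Ioo (0 : ℝ) 1, ContDiffAt ℝ 2 (fun r => q (r - s)) t := fun t ht =>
    ContDiffAt.comp (g := q) t (HellKant.contDiffAt_dilationFun (hqpos (hall t ht).1)) (hsub t)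
  have hsmooth' : ∀ t ∈ Ioo (0 : ℝ) 1, ContDiffAt ℝ 2 (fun r => g (β (r - s))) t := by
    intro t ht
    have h1 : ContDiffAt ℝ 2 g (β (t - s)) :=
      (HellKant.contDiff_det_jacobiField P K).contDiffAt.rpow_const_of_ne (hall t ht).2.2.2.ne'
    exact ContDiffAt.comp (g := g) t h1
      (ContDiffAt.comp (g := β) t (HellKant.contDiffAt_angle (hall t ht).1) (hsub t))
  refine ⟨fun t ht => (hsmooth t ht).contDiffWithinAt, ?_, fun t ht => ?_⟩
  · exact ContDiffOn.congr (fun t ht => ((hsmooth t ht).mul (hsmooth' t ht)).contDiffWithinAt) hρ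
  obtain ⟨ha, hdiff, hdet, hdetpos⟩ := hall t ht
  have hq0 : 0 < q (t - s) := Real.sqrt_pos.2 (hqpos ha)
  have hg0 : 0 < g (β (t - s)) := Real.rpow_pos_of_pos hdetpos _
  have haev : ∀ᶠ τ in 𝓝 (t - s), 0 < 1 + 2 * τ * f := by
    have : Continuous fun τ : ℝ => 1 + 2 * τ * f := by fun_prop
    exact this.continuousAt.eventually (lt_mem_nhds ha)
  have hq1 := haev.mono fun τ h => HellKant.hasDerivAt_dilationFun (hqpos h)
  have hq2 := HellKant.hasDerivAt_dilationFun_deriv (hqpos ha)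
  have hβ1 := haev.mono fun τ h => HellKant.hasDerivAt_angle (p := p) h
  obtain ⟨c, hc, hcle, hceq⟩ := HellKant.exists_hasSecondDerivAt_det_rpow
    (HellKant.dirProj_transpose p) (HellKant.dirProj_mul_self p)
    (HellKant.det_blockScalar_dirProj p) (HellKant.normHess_transpose p hsymm) hdetpos
  rw [Fintype.card_fin] at hc hcle hceq
  have hρ2 := HellKant.hasSecondDerivAt_timeChange hq1 hq2
    (haev.mono fun τ h => Real.sqrt_pos.2 (hqpos h)) hβ1 hc
  have hshift : ∀ {F : ℝ → ℝ} {a : ℝ}, HellKant.HasSecondDerivAt F a (t - s) →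
      HellKant.HasSecondDerivAt (fun r => F (r - s)) a t := by
    rintro F a ⟨F', h1, h2⟩
    have hlim : Tendsto (fun r => r - s) (𝓝 t) (𝓝 (t - s)) := (hsub t).continuousAt.tendsto
    exact ⟨fun r => F' (r - s), (hlim.eventually h1).mono fun r hr => hr.comp_sub_const r s,
      h2.comp_sub_const t s⟩
  have hγ'' : iteratedDeriv 2 (fun r : ℝ => HellKant.gammaFun φ₀ s r x) t =
      ‖p‖ ^ 2 / q (t - s) ^ 3 := by
    rw [iteratedDeriv_succ, iteratedDeriv_one, hγ]
    exact (hshift ⟨_, hq1, hq2⟩).deriv_deriv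
  have hρ'' : iteratedDeriv 2 (fun r : ℝ => HellKant.rhoFun φ₀ φ₁ s r x) t =
      ‖p‖ ^ 2 / q (t - s) ^ 3 * g (β (t - s)) + c * HellKant.speed p ^ 2 / q (t - s) ^ 3 := by
    rw [iteratedDeriv_succ, iteratedDeriv_one]
    refine ((hshift hρ2).congr ?_).deriv_deriv
    filter_upwards [isOpen_Ioo.mem_nhds ht] with r hr using (hρ r hr).symm
  -- This identity also covers p = 0, where the speed is set to 1 but the direction is 0.
  have hk := HellKant.norm_dir_sq_mul_speed_sq p
  rw [hγ'', hρ'', hρ t ht, hdet, show HellKant.gammaFun φ₀ s t x = q (t - s) from rfl]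
  -- The right side is the formula for ρ''/ρ with c replaced by its bound -(4k/d)g. The inequality
  -- is then monotonicity in c, and the equality is substitution.
  have hrhs : (1 - 4 / (d : ℝ)) * (‖p‖ ^ 2 / q (t - s) ^ 3 / q (t - s)) =
      (‖p‖ ^ 2 / q (t - s) ^ 3 * g (β (t - s)) +
        -(4 * ‖HellKant.dir p‖ ^ 2 / d) * g (β (t - s)) * HellKant.speed p ^ 2 / q (t - s) ^ 3) /
        (q (t - s) * g (β (t - s))) := by
    rw [← hk]
    field_simp
    ring
  refine ⟨hdiff, hdetpos, hq0, mul_pos hq0 hg0, by positivity, fun _ => ?_, fun h1 => ?_⟩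
  · rw [hrhs]
    have : c ≤ -(4 * ‖HellKant.dir p‖ ^ 2 / d) * g (β (t - s)) := hcle
    gcongr
  · rw [hrhs]
    have : c = -(4 * ‖HellKant.dir p‖ ^ 2 / d) * g (β (t - s)) := hceq h1
    rw [this]
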